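/- Let $d\ge 3$, $0<b<2$, $0<\sigma<\frac{4-2b}{d-2}$, $\omega>0$, and let $c\neq 0$ satisfy $c<c(d):=\left(\frac{d-2}{2}\right)^2$. For $u\in H^1=H^1(\mathbb R^d;\mathbb C)$ put $$\|u\|_{\dot H^1_c}^2:=\|\nabla u\|_{L^2}^2-c\,\||x|^{-1}u\|_{L^2}^2,\qquad E(u):=\tfrac12\|u\|_{\dot H^1_c}^2-\tfrac1{\sigma+2}\int_{\mathbb R^d}|x|^{-b}|u|^{\sigma+2}\,dx,$$ $$S_\omega(u):=E(u)+\tfrac{\omega}{2}\|u\|_{L^2}^2 .$$ Let $\mathcal A_\omega:=\{u\in H^1\setminus\{0\}:\ S_\omega'(u)=0\}$, where $S_\omega'$ is the (real) Fréchet derivative on $H^1$; the equation $S_\omega'(\phi)=0$ is the variational form of $$-\Delta\phi+\omega\phi-c|x|^{-2}\phi-|x|^{-b}|\phi|^{\sigma}\phi=0 .$$ The set of ground states is $\mathcal G_\omega:=\{u\in\mathcal A_\omega:\ S_\omega(u)\le S_\omega(v)\ \text{for all } v\in\mathcal A_\omega\}$. Then $\mathcal G_\omega$ is nonempty and $$\mathcal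 G_\omega=\{u\in H^1:\ S_\omega(u)=s(\omega),\ K_\omega(u)=0\},$$ where $$K_\omega(u):=\partial_\lambda S_\omega(\lambda u)\big|_{\lambda=1}=\|u\|_{\dot H^1_c}^2+\omega\|u\|_{L^2}^2-\int_{\mathbb R^d}|x|^{-b}|u|^{\sigma+2}\,dx$$ is the Nehari functional and $$s(\omega):=\inf\{S_\omega(u):\ u\in H^1\setminus\{0\},\ K_\omega(u)=0\},$$ this infimum being that of a nonempty set bounded below. -/

import Mathlib

open MeasureTheory

noncomputable section

namespace INLS

/-- Square-integrable functions `ℝ^d → F`, with respect to Lebesgue measure. -/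
abbrev L2 (d : ℕ) (F : Type) [NormedAddCommGroup F] : Type :=
  Lp F 2 (volume : Measure (EuclideanSpace ℝ (Fin d)))

/-- `g` is the weak gradient of `u`: `∫ u ∂ᵢφ = - ∫ gᵢ φ` for every real test function
`φ ∈ C_c^∞(ℝ^d)` and every direction `i`. -/
def IsWeakGradient {d : ℕ} (u : L2 d ℂ) (g : L2 d (EuclideanSpace ℂ (Fin d))) : Prop :=
  ∀ φ : EuclideanSpace ℝ (Fin d) → ℝ, ContDiff ℝ (⊤ : ℕ∞) φ → HasCompactSupport φ → ∀ i : Fin d,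
    ∫ x, fderiv ℝ φ x (EuclideanSpace.single i 1) • u x = - ∫ x, φ x • g x i

theorem memLp_test {d : ℕ} {φ : EuclideanSpace ℝ (Fin d) → ℝ} (hφ : Continuous φ)
    (hc : HasCompactSupport φ) : MemLp φ 2 volume :=
  hφ.memLp_of_hasCompactSupport hc

theorem memLp_partial {d : ℕ} {φ : EuclideanSpace ℝ (Fin d) → ℝ} (hφ : ContDiff ℝ (⊤ : ℕ∞) φ)
    (hc : HasCompactSupport φ) (v : EuclideanSpace ℝ (Fin d)) :
    MemLp (fun x => fderiv ℝ φ x v) 2 volume :=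
  memLp_test ((hφ.continuous_fderiv (by simp)).clm_apply continuous_const)
    (hc.fderiv_apply (𝕜 := ℝ) v)

theorem integrable_test_smul {d : ℕ} {F : Type} [NormedAddCommGroup F] [NormedSpace ℝ F]
    {ψ : EuclideanSpace ℝ (Fin d) → ℝ} {f : EuclideanSpace ℝ (Fin d) → F}
    (hψ : MemLp ψ 2 volume) (hf : MemLp f 2 volume) :
    Integrable (fun x => ψ x • f x) volume :=
  memLp_one_iff_integrable.1 (hf.smul hψ)

theorem memLp_coord {d : ℕ} (g : L2 d (EuclideanSpace ℂ (Fin d))) (i : Fin d) :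
    MemLp (fun x => g x i) 2 volume :=
  (EuclideanSpace.proj (𝕜 := ℂ) i).comp_memLp' (Lp.memLp g)

/-- The Sobolev space `H¹(ℝ^d; ℂ)`: pairs of a function `u ∈ L²` and its weak gradient
`∇u ∈ L²`, with the norm `‖u‖² = ‖u‖²_{L²} + ‖∇u‖²_{L²}`. -/
def H1 (d : ℕ) : Submodule ℂ (WithLp 2 (L2 d ℂ × L2 d (EuclideanSpace ℂ (Fin d)))) where
  carrier := {p | IsWeakGradient p.fst p.snd}
  zero_mem' := by
    intro φ _ _ i
    simp
  add_mem' := by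
    intro p q hp hq φ hφ hc i
    have h1 : (fun x => fderiv ℝ φ x (EuclideanSpace.single i 1) • (p.fst + q.fst) x)
        =ᵐ[volume] fun x => fderiv ℝ φ x (EuclideanSpace.single i 1) • p.fst x
          + fderiv ℝ φ x (EuclideanSpace.single i 1) • q.fst x := by
      filter_upwards [Lp.coeFn_add p.fst q.fst] with x hx
      simp only [hx, Pi.add_apply, smul_add]
    have h2 : (fun x => φ x • (p.snd + q.snd) x i)
        =ᵐ[volume] fun x => φ x • p.snd x i + φ x • q.snd x i := by
      filter_upwards [Lp.coeFn_add p.snd q.snd] with x hx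
      simp only [hx, Pi.add_apply, PiLp.add_apply, smul_add]
    have hd := memLp_partial hφ hc (EuclideanSpace.single i 1)
    have hm := memLp_test hφ.continuous hc
    simp only [WithLp.add_fst, WithLp.add_snd]
    rw [integral_congr_ae h1, integral_congr_ae h2,
      integral_add (integrable_test_smul hd (Lp.memLp p.fst))
        (integrable_test_smul hd (Lp.memLp q.fst)),
      integral_add (integrable_test_smul hm (memLp_coord p.snd i))
        (integrable_test_smul hm (memLp_coord q.snd i)),
      hp φ hφ hc i, hq φ hφ hc i]
    ring
  smul_mem' := by
    intro a p hp φ hφ hc i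
    have h1 : (fun x => fderiv ℝ φ x (EuclideanSpace.single i 1) • (a • p.fst) x)
        =ᵐ[volume] fun x => a • (fderiv ℝ φ x (EuclideanSpace.single i 1) • p.fst x) := by
      filter_upwards [Lp.coeFn_smul a p.fst] with x hx
      simp only [hx, Pi.smul_apply]
      rw [smul_comm]
    have h2 : (fun x => φ x • (a • p.snd) x i)
        =ᵐ[volume] fun x => a • (φ x • p.snd x i) := by
      filter_upwards [Lp.coeFn_smul a p.snd] with x hx
      simp only [hx, Pi.smul_apply, PiLp.smul_apply]
      rw [smul_comm]
    simp only [WithLp.smul_fst, WithLp.smul_snd]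
    rw [integral_congr_ae h1, integral_congr_ae h2, integral_smul, integral_smul,
      hp φ hφ hc i, smul_neg]

/-- The underlying function of `u ∈ H¹`. -/
def H1.fn {d : ℕ} (u : H1 d) : EuclideanSpace ℝ (Fin d) → ℂ := u.1.fst

/-- The weak gradient of `u ∈ H¹`. -/
def H1.grad {d : ℕ} (u : H1 d) : EuclideanSpace ℝ (Fin d) → EuclideanSpace ℂ (Fin d) := u.1.snd

/-- `‖u‖²_{L²}`. -/
def mass {d : ℕ} (u : H1 d) : ℝ := ∫ x, ‖H1.fn u x‖ ^ 2

/-- The Hardy functional `‖∇u‖²_{L²} - c ‖|x|⁻¹ u‖²_{L²}`. -/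
def hardy {d : ℕ} (c : ℝ) (u : H1 d) : ℝ :=
  (∫ x, ‖H1.grad u x‖ ^ 2) - c * ∫ x, (‖x‖⁻¹ * ‖H1.fn u x‖) ^ 2

/-- `∫ |x|^{-b} |u|^{σ+2} dx`. -/
def potential {d : ℕ} (b σ : ℝ) (u : H1 d) : ℝ :=
  ∫ x, ‖x‖ ^ (-b) * ‖H1.fn u x‖ ^ (σ + 2)

/-- The energy `E`. -/
def energy {d : ℕ} (b σ c : ℝ) (u : H1 d) : ℝ :=
  1 / 2 * hardy c u - 1 / (σ + 2) * potential b σ u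

/-- The action functional `S_ω = E + (ω/2) ‖·‖²_{L²}`. -/
def action {d : ℕ} (b σ c ω : ℝ) (u : H1 d) : ℝ :=
  energy b σ c u + ω / 2 * mass u

/-- The Nehari functional `K_ω`. -/
def nehari {d : ℕ} (b σ c ω : ℝ) (u : H1 d) : ℝ :=
  hardy c u + ω * mass u - potential b σ u

/-- `𝒜_ω`: the nonzero `u ∈ H¹` at which the (real) Fréchet derivative of `S_ω` on `H¹` exists
and vanishes. -/
def criticalSet (d : ℕ) (b σ c ω : ℝ) : Set (H1 d) :=
  {u | u ≠ 0 ∧ HasFDerivAt (action b σ c ω) (0 : H1 d →L[ℝ] ℝ) u}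

/-- `𝒢_ω`: the ground states, i.e. the minimizers of `S_ω` over `𝒜_ω`. -/
def groundStates (d : ℕ) (b σ c ω : ℝ) : Set (H1 d) :=
  {u | u ∈ criticalSet d b σ c ω ∧
    ∀ v ∈ criticalSet d b σ c ω, action b σ c ω u ≤ action b σ c ω v}

/-- The values `S_ω(u)` for nonzero `u ∈ H¹` with `K_ω(u) = 0`. -/
def nehariValues (d : ℕ) (b σ c ω : ℝ) : Set ℝ :=
  {r | ∃ u : H1 d, u ≠ 0 ∧ nehari b σ c ω u = 0 ∧ action b σ c ω u = r}

/-- `s(ω) = inf {S_ω(u) : u ∈ H¹ \ {0}, K_ω(u) = 0}`. -/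
def groundLevel (d : ℕ) (b σ c ω : ℝ) : ℝ := sInf (nehariValues d b σ c ω)

end INLS

end

noncomputable section

open Filter Topology ENNReal

namespace INLS

/-! Write `Q` for the quadratic part `quad` and `P` for `potential`, so that `S = Q/2 - P/(σ+2)` and
`K = Q - P`. On the Nehari set `P = Q`, hence `S = θ Q` with `θ = 1/2 - 1/(σ+2) > 0`, and minimizing
`S` there means minimizing `Q`. Let `M` be the best constant in `P ≤ M Q^((σ+2)/2)`. With `P = Q >
0` the inequality reads `Q ≥ m := M^(-2/σ)`, and a point of the Nehari set with `Q = m` gives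
equality in it. So the Nehari problem is the problem of the best constant, up to scaling
(`exists_nehari_level`).

The best constant is attained by the direct method (`exists_isMaxOn_potential`). Hardy's inequality
and `c < c(d)` make `Q` coercive, so a maximizing sequence for `P` on `Q ≤ 1` has a weak limit, and
`Q` is weakly lower semicontinuous. `P` passes to the limit (`tendsto_lpotential_of_weak`): on a
ball by Rellich's theorem and interpolation between Hardy, `L²` and Sobolev, and outside it because
the weight `|x|^(-b)` is small there. Thus no mass is lost at infinity, and neither radial symmetry
nor profile decompositions are needed.

No Lagrange multiplier is needed for the equation, nor differentiability of `P` on all of `H¹`. `P`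
is midpoint convex and lies below the differentiable function `M Q^((σ+2)/2)`. Where the two agree,
`P` inherits its derivative (`hasFDerivAt_of_touching`), and with `P = Q` this gives `S' = 0`.
Conversely, differentiating `S` along the ray through a critical point gives `K = 0`, so critical
points lie on the Nehari set and the two minimization problems have the same solutions.

The inequalities on `H¹` are proved for test functions and transferred by Fatou's lemma. This needs
only a.e. convergence and an asymptotic bound on the gradients (`exists_testFunction_approx`). -/

/-! ### Averages in `L²` -/

theorem eLpNorm_two_sq {α F : Type*} [MeasurableSpace α] [NormedAddCommGroup F] (f : α → F)
    (μ : Measure α) : eLpNorm f 2 μ ^ 2 = ∫⁻ x, ‖f x‖ₑ ^ 2 ∂μ := by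
  have h := eLpNorm_nnreal_pow_eq_lintegral (f := f) (μ := μ) (p := 2) (by norm_num)
  simpa using h

/-- Jensen's inequality for the square and the weight `w`. -/
theorem lintegral_mul_sq_le {α : Type*} [MeasurableSpace α] {μ : Measure α} {w G : α → ℝ≥0∞}
    (hw : AEMeasurable w μ) (hG : AEMeasurable G μ) :
    (∫⁻ x, w x * G x ∂μ) ^ 2 ≤ (∫⁻ x, w x ∂μ) * ∫⁻ x, w x * G x ^ 2 ∂μ := by
  have h := ENNReal.lintegral_mul_norm_pow_le (μ := μ) (f := w) (g := fun x => w x * G x ^ 2)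
    hw (hw.mul (hG.pow_const 2)) (p := 1 / 2) (q := 1 / 2) (by norm_num) (by norm_num)
    (by norm_num)
  have e : ∀ x, w x ^ (1 / 2 : ℝ) * (w x * G x ^ 2) ^ (1 / 2 : ℝ) = w x * G x := by
    intro x
    rw [ENNReal.mul_rpow_of_nonneg _ _ (by norm_num), ← mul_assoc,
      ← ENNReal.rpow_add_of_nonneg _ _ (by norm_num) (by norm_num), ← ENNReal.rpow_natCast,
      ← ENNReal.rpow_mul]
    norm_num
  simp only [e] at h
  calc (∫⁻ x, w x * G x ∂μ) ^ 2 ≤ _ := pow_le_pow_left' h 2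
    _ = _ := by
      rw [← ENNReal.mul_rpow_of_nonneg _ _ (by norm_num), ← ENNReal.rpow_natCast,
        ← ENNReal.rpow_mul]
      norm_num

/-- Averaging a family of functions does not increase the `L²` norm. -/
theorem lintegral_sq_convolution_le {E : Type*} [NormedAddCommGroup E] [MeasurableSpace E]
    [BorelSpace E] [SecondCountableTopology E] {μ : Measure E} [SFinite μ]
    [μ.IsAddLeftInvariant] [μ.IsNegInvariant]
    {w F : E → ℝ≥0∞} (hw : Measurable w) (hw1 : ∫⁻ x, w x ∂μ = 1) (hF : Measurable F) :
    ∫⁻ x, (∫⁻ t, w (x - t) * F t ∂μ) ^ 2 ∂μ ≤ ∫⁻ x, F x ^ 2 ∂μ := by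
  calc ∫⁻ x, (∫⁻ t, w (x - t) * F t ∂μ) ^ 2 ∂μ
      ≤ ∫⁻ x, ∫⁻ t, w (x - t) * F t ^ 2 ∂μ ∂μ := by
        gcongr with x
        refine (lintegral_mul_sq_le (by fun_prop) (by fun_prop)).trans ?_
        rw [lintegral_sub_left_eq_self w x, hw1, one_mul]
    _ = ∫⁻ t, ∫⁻ x, w (x - t) * F t ^ 2 ∂μ ∂μ := lintegral_lintegral_swap (by fun_prop)
    _ = ∫⁻ t, F t ^ 2 ∂μ := by
        congr with t
        rw [lintegral_mul_const _ (by fun_prop), lintegral_sub_right_eq_self w t, hw1, one_mul]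

theorem eLpNorm_integral_smul_le {E F : Type*} [NormedAddCommGroup E] [MeasurableSpace E]
    [BorelSpace E] [SecondCountableTopology E] {μ : Measure E} [SFinite μ]
    [μ.IsAddLeftInvariant] [μ.IsNegInvariant] [NormedAddCommGroup F] [NormedSpace ℝ F]
    {η : E → ℝ} (hη : Measurable η) (h0 : ∀ x, 0 ≤ η x) (hi : Integrable η μ)
    (h1 : ∫ x, η x ∂μ = 1) {f : E → F} (hf : StronglyMeasurable f) :
    eLpNorm (fun x => ∫ t, η (x - t) • f t ∂μ) 2 μ ≤ eLpNorm f 2 μ := by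
  rw [← ENNReal.pow_le_pow_left_iff (two_ne_zero), eLpNorm_two_sq, eLpNorm_two_sq]
  refine le_trans ?_ (lintegral_sq_convolution_le (μ := μ) (w := fun x => ‖η x‖ₑ)
    (F := fun x => ‖f x‖ₑ) (by fun_prop) ?_ hf.enorm)
  · gcongr with x
    refine (enorm_integral_le_lintegral_enorm _).trans (le_of_eq ?_)
    simp [enorm_smul]
  · have : ∀ x, ‖η x‖ₑ = ENNReal.ofReal (η x) := fun x => Real.enorm_of_nonneg (h0 x)
    simp only [this]
    rw [← ofReal_integral_eq_lintegral_ofReal hi (Eventually.of_forall h0), h1, ofReal_one]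

variable {d : ℕ}

/-! ### Approximation of `H¹` functions by test functions -/

/-- Cauchy–Schwarz. No dimensional constant is lost, so the Hardy constant stays exactly `c(d)⁻¹` in
the passage to weak gradients. -/
theorem norm_fderiv_le_of_apply_single {D : EuclideanSpace ℝ (Fin d) →L[ℝ] ℂ}
    {G : EuclideanSpace ℂ (Fin d)} (h : ∀ i, D (EuclideanSpace.single i 1) = G i) :
    ‖D‖ ≤ ‖G‖ := by
  refine D.opNorm_le_bound (norm_nonneg _) fun v => ?_
  have hv : v = ∑ i, v i • EuclideanSpace.single i (1 : ℝ) := by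
    ext j
    simp [Finset.sum_apply, Pi.single_apply]
  have hD : D v = inner ℂ (WithLp.toLp 2 (fun i => ((v i : ℝ) : ℂ)) : EuclideanSpace ℂ (Fin d)) G := by
    conv_lhs => rw [hv]
    simp [PiLp.inner_apply, h, mul_comm]
  rw [hD]
  refine (norm_inner_le_norm _ _).trans (le_of_eq ?_)
  rw [mul_comm]
  congr 1
  simp [EuclideanSpace.norm_eq]

/-- The mollification of `u`. -/
def mollify {F : Type*} [NormedAddCommGroup F] [NormedSpace ℝ F]
    (η : ContDiffBump (0 : EuclideanSpace ℝ (Fin d))) (f : EuclideanSpace ℝ (Fin d) → F)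
    (x : EuclideanSpace ℝ (Fin d)) : F :=
  ∫ t, η.normed volume (x - t) • f t

theorem mollify_eq_convolution {F : Type*} [NormedAddCommGroup F] [NormedSpace ℝ F]
    (η : ContDiffBump (0 : EuclideanSpace ℝ (Fin d))) (f : EuclideanSpace ℝ (Fin d) → F) :
    mollify η f = convolution (η.normed volume) f (ContinuousLinearMap.lsmul ℝ ℝ) volume := by
  ext x
  rw [convolution_eq_swap]
  rfl

theorem contDiff_mollify {F : Type*} [NormedAddCommGroup F] [NormedSpace ℝ F] [CompleteSpace F]
    (η : ContDiffBump (0 : EuclideanSpace ℝ (Fin d))) {f : EuclideanSpace ℝ (Fin d) → F}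
    (hf : LocallyIntegrable f volume) : ContDiff ℝ (⊤ : ℕ∞) (mollify η f) := by
  rw [mollify_eq_convolution]
  exact η.hasCompactSupport_normed.contDiff_convolution_left _ η.contDiff_normed hf

theorem eLpNorm_mollify_le {F : Type*} [NormedAddCommGroup F] [NormedSpace ℝ F]
    (η : ContDiffBump (0 : EuclideanSpace ℝ (Fin d))) {f : EuclideanSpace ℝ (Fin d) → F}
    (hf : StronglyMeasurable f) : eLpNorm (mollify η f) 2 volume ≤ eLpNorm f 2 volume :=
  eLpNorm_integral_smul_le (η.continuous_normed.measurable) η.nonneg_normed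
    η.integrable_normed η.integral_normed hf

theorem locallyIntegrable_lp {F : Type} [NormedAddCommGroup F] (f : L2 d F) :
    LocallyIntegrable f volume :=
  (Lp.memLp f).locallyIntegrable (by norm_num)

/-- The derivative falls on the kernel, and `t ↦ η(x - t)` is a test function for the weak gradient.
The sign from reflecting the variable cancels the sign from integrating by parts. -/
theorem norm_fderiv_mollify_le (η : ContDiffBump (0 : EuclideanSpace ℝ (Fin d))) (u : H1 d)
    (x : EuclideanSpace ℝ (Fin d)) :
    ‖fderiv ℝ (mollify η (H1.fn u)) x‖ ≤ ‖mollify η (H1.grad u) x‖ := by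
  have hlu : LocallyIntegrable (H1.fn u) volume := locallyIntegrable_lp _
  have hlg : LocallyIntegrable (H1.grad u) volume := locallyIntegrable_lp _
  have hηs : ContDiff ℝ (⊤ : ℕ∞) (η.normed volume) := η.contDiff_normed
  have hη1 : ContDiff ℝ 1 (η.normed volume) := η.contDiff_normed
  refine norm_fderiv_le_of_apply_single fun i => ?_
  have hD := (η.hasCompactSupport_normed (μ := volume)).hasFDerivAt_convolution_right
    (ContinuousLinearMap.lsmul ℝ ℝ).flip hlu hη1 x
  rw [convolution_flip, ← mollify_eq_convolution] at hD
  rw [hD.fderiv, convolution_precompR_apply _ hlu (η.hasCompactSupport_normed.fderiv ℝ)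
    (hη1.continuous_fderiv (by simp))]
  simp only [convolution_def, ContinuousLinearMap.flip_apply, ContinuousLinearMap.lsmul_apply]
  have hφs : ContDiff ℝ (⊤ : ℕ∞) (fun t => η.normed volume (x - t)) :=
    hηs.comp (contDiff_const.sub contDiff_id)
  have hφc : HasCompactSupport (fun t => η.normed volume (x - t)) :=
    (η.hasCompactSupport_normed (μ := volume)).comp_homeomorph (Homeomorph.subLeft x)
  have key := u.2 _ hφs hφc i
  have hder : ∀ t, fderiv ℝ (fun t => η.normed volume (x - t)) t (EuclideanSpace.single i 1)
      = - fderiv ℝ (η.normed volume) (x - t) (EuclideanSpace.single i 1) := by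
    intro t
    have h1 := ((hη1.differentiable (by simp)) (x - t)).hasFDerivAt.comp t
      ((hasFDerivAt_id t).const_sub x)
    have h2 : HasFDerivAt (fun t => η.normed volume (x - t)) _ t := h1
    rw [h2.fderiv]
    simp
  simp only [hder, neg_smul, integral_neg, neg_inj] at key
  refine key.trans ?_
  have hint : Integrable (fun t => η.normed volume (x - t) • H1.grad u t) volume := by
    have := (η.hasCompactSupport_normed (μ := volume)).convolutionExists_left
      (ContinuousLinearMap.lsmul ℝ ℝ) η.continuous_normed hlg x
    exact this.integrable_swap
  have := ((EuclideanSpace.proj i : EuclideanSpace ℂ (Fin d) →L[ℂ] ℂ).restrictScalars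
    ℝ).integral_comp_comm hint
  simpa [mollify, H1.grad] using this

theorem eLpNorm_fderiv_mollify_le (η : ContDiffBump (0 : EuclideanSpace ℝ (Fin d))) (u : H1 d) :
    eLpNorm (fderiv ℝ (mollify η (H1.fn u))) 2 volume ≤ eLpNorm (H1.grad u) 2 volume :=
  (eLpNorm_mono (norm_fderiv_mollify_le η u)).trans
    (eLpNorm_mollify_le η (Lp.stronglyMeasurable _))

/-- Dilated cutoff functions `χ(x / (k + 1))`. -/
def cutoff (χ : ContDiffBump (0 : EuclideanSpace ℝ (Fin d))) (k : ℕ)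
    (x : EuclideanSpace ℝ (Fin d)) : ℝ :=
  χ (((k : ℝ) + 1)⁻¹ • x)

theorem contDiff_cutoff (χ : ContDiffBump (0 : EuclideanSpace ℝ (Fin d))) (k : ℕ) :
    ContDiff ℝ (⊤ : ℕ∞) (cutoff χ k) :=
  χ.contDiff.comp (contDiff_const_smul _)

theorem hasCompactSupport_cutoff (χ : ContDiffBump (0 : EuclideanSpace ℝ (Fin d))) (k : ℕ) :
    HasCompactSupport (cutoff χ k) :=
  χ.hasCompactSupport.comp_homeomorph (Homeomorph.smulOfNeZero ((k : ℝ) + 1)⁻¹ (by positivity))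

theorem cutoff_mem_Icc (χ : ContDiffBump (0 : EuclideanSpace ℝ (Fin d))) (k : ℕ)
    (x : EuclideanSpace ℝ (Fin d)) : cutoff χ k x ∈ Set.Icc 0 1 :=
  ⟨χ.nonneg, χ.le_one⟩

theorem tendsto_cutoff (χ : ContDiffBump (0 : EuclideanSpace ℝ (Fin d)))
    (x : EuclideanSpace ℝ (Fin d)) : Tendsto (fun k => cutoff χ k x) atTop (𝓝 1) := by
  have h : Tendsto (fun k : ℕ => ((k : ℝ) + 1)⁻¹ • x) atTop (𝓝 0) := by
    have := (tendsto_one_div_add_atTop_nhds_zero_nat (𝕜 := ℝ)).smul_const x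
    simpa using this
  have h2 := (χ.continuous.tendsto 0).comp h
  rwa [χ.one_of_mem_closedBall (by simpa using χ.rIn_pos.le)] at h2

theorem exists_norm_fderiv_cutoff_le (χ : ContDiffBump (0 : EuclideanSpace ℝ (Fin d))) :
    ∃ C : ℝ, ∀ k x, ‖fderiv ℝ (cutoff χ k) x‖ ≤ C * (1 / ((k : ℝ) + 1)) := by
  have hχ : ContDiff ℝ 1 χ := χ.contDiff
  obtain ⟨C, hC⟩ := (χ.hasCompactSupport.fderiv ℝ).exists_bound_of_continuous
    (hχ.continuous_fderiv (by simp))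
  refine ⟨C, fun k x => ?_⟩
  have h1 : HasFDerivAt (cutoff χ k) _ x :=
    ((hχ.differentiable (by simp)) (((k : ℝ) + 1)⁻¹ • x)).hasFDerivAt.comp x
      ((hasFDerivAt_id x).const_smul ((k : ℝ) + 1)⁻¹)
  rw [h1.fderiv, ContinuousLinearMap.comp_smul, norm_smul, mul_comm, one_div, Real.norm_eq_abs,
    abs_of_pos (by positivity : 0 < ((k : ℝ) + 1)⁻¹)]
  have : 0 ≤ ((k : ℝ) + 1)⁻¹ := by positivity
  gcongr
  simpa using hC (((k : ℝ) + 1)⁻¹ • x)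

/-- Every `u ∈ H¹` is the a.e. limit of test functions whose gradients are asymptotically not
larger in `L²` than that of `u`. -/
theorem exists_testFunction_approx (u : H1 d) :
    ∃ (φ : ℕ → EuclideanSpace ℝ (Fin d) → ℂ) (δ : ℕ → ℝ≥0∞),
      (∀ k, ContDiff ℝ (⊤ : ℕ∞) (φ k)) ∧ (∀ k, HasCompactSupport (φ k)) ∧
      (∀ᵐ x, Tendsto (fun k => φ k x) atTop (𝓝 (H1.fn u x))) ∧ Tendsto δ atTop (𝓝 0) ∧
      ∀ k, eLpNorm (fderiv ℝ (φ k)) 2 volume ≤ eLpNorm (H1.grad u) 2 volume + δ k := by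
  have hlu : LocallyIntegrable (H1.fn u) volume := locallyIntegrable_lp _
  -- The ratio of outer to inner radius stays equal to 2; the a.e. convergence of mollifications
  -- needs it bounded.
  let η : ℕ → ContDiffBump (0 : EuclideanSpace ℝ (Fin d)) := fun k =>
    ⟨1 / ((k : ℝ) + 1), 2 * (1 / ((k : ℝ) + 1)), by positivity,
      lt_mul_of_one_lt_left (by positivity) (by norm_num)⟩
  let χ : ContDiffBump (0 : EuclideanSpace ℝ (Fin d)) := ⟨1, 2, by norm_num, by norm_num⟩
  obtain ⟨C, hC⟩ := exists_norm_fderiv_cutoff_le χ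
  let v : ℕ → EuclideanSpace ℝ (Fin d) → ℂ := fun k => mollify (η k) (H1.fn u)
  have hv : ∀ k, ContDiff ℝ (⊤ : ℕ∞) (v k) := fun k => contDiff_mollify _ hlu
  have hr : Tendsto (fun k : ℕ => 1 / ((k : ℝ) + 1)) atTop (𝓝 0) :=
    tendsto_one_div_add_atTop_nhds_zero_nat
  have hfin : eLpNorm (H1.fn u) 2 volume ≠ ∞ := (Lp.memLp u.1.fst).eLpNorm_ne_top
  refine ⟨fun k x => cutoff χ k x • v k x,
    -- The error `δ k` is the term in which the derivative falls on the cutoff, whose gradient is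
    -- `O(1/(k+1))`.
    fun k => ENNReal.ofReal (C * (1 / ((k : ℝ) + 1))) * eLpNorm (H1.fn u) 2 volume,
    fun k => (contDiff_cutoff χ k).smul (hv k), fun k => (hasCompactSupport_cutoff χ k).smul_right,
    ?_, ?_, fun k => ?_⟩
  · have := ContDiffBump.ae_convolution_tendsto_right_of_locallyIntegrable (μ := volume) (φ := η)
      (l := atTop) (K := 2) (by simpa only [mul_zero] using hr.const_mul 2) (Eventually.of_forall fun k => le_rfl)
      hlu
    filter_upwards [this] with x hx
    have h2 := (tendsto_cutoff χ x).smul hx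
    simpa only [← mollify_eq_convolution, one_smul] using h2
  · have h1 : Tendsto (fun k : ℕ => ENNReal.ofReal (C * (1 / ((k : ℝ) + 1)))) atTop (𝓝 0) := by
      simpa using ENNReal.tendsto_ofReal (hr.const_mul C)
    simpa using ENNReal.Tendsto.mul_const h1 (Or.inr hfin)
  · have hdc := (contDiff_cutoff χ k).differentiable (by simp)
    have hdv := (hv k).differentiable (by simp)
    have e : fderiv ℝ (fun x => cutoff χ k x • v k x) = (fun x => cutoff χ k x • fderiv ℝ (v k) x)
        + fun x => (fderiv ℝ (cutoff χ k) x).smulRight (v k x) := by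
      ext1 x
      exact fderiv_fun_smul (hdc x) (hdv x)
    have m1 : Continuous (fderiv ℝ (v k)) := (hv k).continuous_fderiv (by simp)
    have m2 : Continuous (fderiv ℝ (cutoff χ k)) := (contDiff_cutoff χ k).continuous_fderiv (by simp)
    have m3 := (contDiff_cutoff χ k).continuous
    have m4 := (hv k).continuous
    rw [e]
    refine (eLpNorm_add_le (m3.smul m1).aestronglyMeasurable
      (Continuous.aestronglyMeasurable (by fun_prop)) (by norm_num)).trans ?_
    gcongr ?_ + ?_
    · refine le_trans (eLpNorm_mono fun x => ?_) (eLpNorm_fderiv_mollify_le (η k) u)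
      obtain ⟨h0, h1⟩ := cutoff_mem_Icc χ k x
      rw [Pi.smul_apply', norm_smul, Real.norm_of_nonneg h0]
      exact mul_le_of_le_one_left (norm_nonneg _) h1
    · refine (eLpNorm_le_mul_eLpNorm_of_ae_le_mul (c := C * (1 / ((k : ℝ) + 1)))
        (g := v k) (Eventually.of_forall fun x => ?_) 2).trans ?_
      · rw [ContinuousLinearMap.norm_smulRight_apply]
        gcongr
        exact hC k x
      · refine mul_le_mul_right ?_ _
        exact eLpNorm_mollify_le _ (Lp.stronglyMeasurable _)

/-! ### Hardy's inequality -/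

/-- Fatou's lemma, in the form that carries inequalities from test functions to `H¹`. -/
theorem lintegral_le_of_tendsto_ae {α : Type*} [MeasurableSpace α] {μ : Measure α}
    {F : ℕ → α → ℝ≥0∞} {f : α → ℝ≥0∞} {a : ℕ → ℝ≥0∞} {A : ℝ≥0∞}
    (hF : ∀ k, AEMeasurable (F k) μ) (h : ∀ᵐ x ∂μ, Tendsto (fun k => F k x) atTop (𝓝 (f x)))
    (ha : ∀ k, ∫⁻ x, F k x ∂μ ≤ a k) (hA : Tendsto a atTop (𝓝 A)) : ∫⁻ x, f x ∂μ ≤ A := by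
  calc ∫⁻ x, f x ∂μ = ∫⁻ x, liminf (fun k => F k x) atTop ∂μ :=
        lintegral_congr_ae (h.mono fun x hx => hx.liminf_eq.symm)
    _ ≤ liminf (fun k => ∫⁻ x, F k x ∂μ) atTop := lintegral_liminf_le' hF
    _ ≤ liminf a atTop := liminf_le_liminf (Eventually.of_forall ha)
    _ = A := hA.liminf_eq

/-- Integration by parts of `xᵢ ∂ᵢG` in each coordinate, where `∂ᵢxᵢ = 1`; the sum over `i` produces
the factor `d`. -/
theorem integral_fderiv_apply_self {G : EuclideanSpace ℝ (Fin d) → ℝ} (hG : ContDiff ℝ 1 G)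
    (hc : HasCompactSupport G) : ∫ x, fderiv ℝ G x x = -(d * ∫ x, G x) := by
  have hG' : Continuous (fderiv ℝ G) := hG.continuous_fderiv (by simp)
  have hcoord : ∀ i : Fin d, ∫ x : EuclideanSpace ℝ (Fin d),
      x i * fderiv ℝ G x (EuclideanSpace.single i 1) = - ∫ x, G x := by
    intro i
    let f : EuclideanSpace ℝ (Fin d) →L[ℝ] ℝ := EuclideanSpace.proj i
    have hf : ∀ x, fderiv ℝ f x (EuclideanSpace.single i 1) = 1 := by
      intro x
      rw [f.fderiv]
      simp [f]
    have := integral_mul_fderiv_eq_neg_fderiv_mul_of_integrable (𝕜 := ℝ) (f := f) (g := G)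
      (μ := volume)
      (v := EuclideanSpace.single i (1 : ℝ)) ?_ ?_ ?_ (fun x _ => f.differentiableAt)
      (fun x _ => hG.differentiable (by simp) x)
    · simp only [hf, one_mul] at this
      exact this
    · simp only [hf, one_mul]
      exact hG.continuous.integrable_of_hasCompactSupport hc
    · exact (f.continuous.mul (hG'.clm_apply continuous_const)).integrable_of_hasCompactSupport
        ((hc.fderiv_apply (𝕜 := ℝ) _).mul_left)
    · exact (f.continuous.mul hG.continuous).integrable_of_hasCompactSupport hc.mul_left
  have hexp : ∀ x : EuclideanSpace ℝ (Fin d), fderiv ℝ G x x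
      = ∑ i, x i * fderiv ℝ G x (EuclideanSpace.single i 1) := by
    intro x
    have hv : x = ∑ i, x i • EuclideanSpace.single i (1 : ℝ) := by
      ext j
      simp [Finset.sum_apply, Pi.single_apply]
    calc fderiv ℝ G x x = fderiv ℝ G x (∑ i, x i • EuclideanSpace.single i (1 : ℝ)) := by rw [← hv]
      _ = _ := by simp only [map_sum, map_smul, smul_eq_mul]
  simp only [hexp]
  rw [integral_finsetSum]
  · simp [hcoord]
  · intro i _
    have f : Continuous fun x : EuclideanSpace ℝ (Fin d) => x i := by fun_prop
    exact (f.mul (hG'.clm_apply continuous_const)).integrable_of_hasCompactSupport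
      ((hc.fderiv_apply (𝕜 := ℝ) _).mul_left)

/-- Here `n = |φ|`, `D = ‖Dφ‖`, `ρ = |x|` and `I` is the real inner product of `φ` with `Dφ x`. The
cross term is absorbed by expanding the square `a (nρs - a⁻¹D)² ≥ 0`, and the regularization costs
nothing because `ρ² s² ≤ s`. -/
theorem hardy_pointwise_aux {a n D ρ δ I : ℝ} (ha : 0 < a) (hδ : 0 < δ)
    (hI : |I| ≤ n * (D * ρ)) :
    -(n ^ 2 * (-(2 * ρ ^ 2) * ((ρ ^ 2 + δ)⁻¹) ^ 2) + (ρ ^ 2 + δ)⁻¹ * (2 * I)) ≤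
      (a + 2) * (n ^ 2 * (ρ ^ 2 + δ)⁻¹) + a⁻¹ * D ^ 2 := by
  have hr : 0 < ρ ^ 2 + δ := by positivity
  set s := (ρ ^ 2 + δ)⁻¹ with hs
  have hs0 : 0 < s := inv_pos.2 hr
  have h1 : ρ ^ 2 * s ^ 2 ≤ s := by
    have : (ρ ^ 2 + δ) * s = 1 := mul_inv_cancel₀ hr.ne'
    have h2 : ρ ^ 2 * s ≤ 1 := by nlinarith [mul_pos hδ hs0]
    nlinarith
  have h2 : -I ≤ n * (D * ρ) := (neg_le_abs I).trans hI
  have h3 : 0 ≤ a * (n * ρ * s - a⁻¹ * D) ^ 2 := by positivity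
  have h4 : a * (n * ρ * s - a⁻¹ * D) ^ 2
      = a * n ^ 2 * (ρ ^ 2 * s ^ 2) - 2 * (n * (D * ρ)) * s + a⁻¹ * D ^ 2 := by
    field_simp
    ring
  have h5 : n ^ 2 * (ρ ^ 2 * s ^ 2) ≤ n ^ 2 * s := by gcongr
  have h6 : s * -I ≤ s * (n * (D * ρ)) := by gcongr
  have h7 : a * (n ^ 2 * (ρ ^ 2 * s ^ 2)) ≤ a * (n ^ 2 * s) := by gcongr
  linarith

theorem fderiv_hardyWeight_le {φ : EuclideanSpace ℝ (Fin d) → ℂ} (hφ : Differentiable ℝ φ)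
    {a δ : ℝ} (ha : 0 < a) (hδ : 0 < δ) (x : EuclideanSpace ℝ (Fin d)) :
    -(fderiv ℝ (fun x => ‖φ x‖ ^ 2 * (‖x‖ ^ 2 + δ)⁻¹) x x) ≤
      (a + 2) * (‖φ x‖ ^ 2 * (‖x‖ ^ 2 + δ)⁻¹) + a⁻¹ * ‖fderiv ℝ φ x‖ ^ 2 := by
  have hr : (‖x‖ ^ 2 + δ) ≠ 0 := by positivity
  have h1 := (hφ x).hasFDerivAt.norm_sq
  have h2 : HasFDerivAt (fun x : EuclideanSpace ℝ (Fin d) => ‖x‖ ^ 2 + δ) _ x :=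
    ((hasFDerivAt_id (𝕜 := ℝ) x).norm_sq.add_const δ)
  have h3 := (hasDerivAt_inv hr).comp_hasFDerivAt x h2
  have h4 : HasFDerivAt (fun x => ‖φ x‖ ^ 2 * (‖x‖ ^ 2 + δ)⁻¹) _ x := h1.mul h3
  rw [h4.fderiv]
  have hI : |inner ℝ (φ x) (fderiv ℝ φ x x)| ≤ ‖φ x‖ * (‖fderiv ℝ φ x‖ * ‖x‖) :=
    (abs_real_inner_le_norm _ _).trans
      (mul_le_mul_of_nonneg_left ((fderiv ℝ φ x).le_opNorm x) (norm_nonneg _))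
  refine le_trans (le_of_eq ?_) (hardy_pointwise_aux ha hδ hI)
  simp only [id_eq, add_apply, smul_apply,
    ContinuousLinearMap.comp_apply, innerSL_apply_apply, smul_eq_mul,
    nsmul_eq_mul, ContinuousLinearMap.id_apply, real_inner_self_eq_norm_sq]
  push_cast
  field_simp
theorem _root_.HasCompactSupport.norm_sq {E F : Type*} [TopologicalSpace E] [NormedAddCommGroup F]
    {f : E → F} (hf : HasCompactSupport f) : HasCompactSupport fun x => ‖f x‖ ^ 2 := by
  have h : HasCompactSupport ((fun z : F => ‖z‖ ^ 2) ∘ f) := hf.comp_left (by simp)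
  exact h

/-- Hardy's inequality for test functions, with a regularized weight. -/
theorem integral_hardy_testFunction (hd : 3 ≤ d) {φ : EuclideanSpace ℝ (Fin d) → ℂ}
    (hφ : ContDiff ℝ (⊤ : ℕ∞) φ) (hc : HasCompactSupport φ) {δ : ℝ} (hδ : 0 < δ) :
    ∫ x, ‖φ x‖ ^ 2 * (‖x‖ ^ 2 + δ)⁻¹ ≤
      ((((d : ℝ) - 2) / 2) ^ 2)⁻¹ * ∫ x, ‖fderiv ℝ φ x‖ ^ 2 := by
  obtain ⟨a, ha⟩ : ∃ a : ℝ, a = ((d : ℝ) - 2) / 2 := ⟨_, rfl⟩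
  rw [← ha]
  have hd' : (3 : ℝ) ≤ d := by exact_mod_cast hd
  have ha0 : 0 < a := by rw [ha]; linarith
  have hpos : ∀ x : EuclideanSpace ℝ (Fin d), 0 < ‖x‖ ^ 2 + δ := fun x => by positivity
  have hφ1 : ContDiff ℝ 1 φ := hφ.of_le (by exact_mod_cast le_top)
  set G : EuclideanSpace ℝ (Fin d) → ℝ := fun x => ‖φ x‖ ^ 2 * (‖x‖ ^ 2 + δ)⁻¹ with hGdef
  have hG : ContDiff ℝ 1 G :=
    (hφ1.norm_sq ℝ).mul (((contDiff_norm_sq ℝ).add contDiff_const).inv fun x => (hpos x).ne')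
  have hφ2 : HasCompactSupport (fun x => ‖φ x‖ ^ 2) :=
    hc.norm_sq
  have hGc : HasCompactSupport G := hφ2.mul_right
  have hB : Integrable (fun x => ‖fderiv ℝ φ x‖ ^ 2) volume :=
    ((hφ1.continuous_fderiv (by simp)).norm.pow 2).integrable_of_hasCompactSupport
      (hc.fderiv ℝ).norm_sq
  have hGi : Integrable G volume := hG.continuous.integrable_of_hasCompactSupport hGc
  have hder : ∀ x, -(fderiv ℝ G x x) ≤ (a + 2) * G x + a⁻¹ * ‖fderiv ℝ φ x‖ ^ 2 := by
    intro x
    exact fderiv_hardyWeight_le (hφ1.differentiable (by simp)) ha0 hδ x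
  have hE := integral_fderiv_apply_self hG hGc
  have hm : ∫ x, -(fderiv ℝ G x x) ≤ ∫ x, ((a + 2) * G x + a⁻¹ * ‖fderiv ℝ φ x‖ ^ 2) := by
    refine integral_mono ?_ ((hGi.const_mul _).add (hB.const_mul _)) hder
    refine Integrable.neg (Continuous.integrable_of_hasCompactSupport ?_ ?_)
    · exact (hG.continuous_fderiv (by simp)).clm_apply continuous_id
    · exact (hGc.fderiv ℝ).mono' fun x hx => subset_tsupport _ (by
        intro h
        apply hx
        simp [h])
  rw [integral_neg, hE, neg_neg, integral_add (hGi.const_mul _) (hB.const_mul _),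
    integral_const_mul, integral_const_mul] at hm
  -- With `d = 2a + 2`, the bound `d ∫G ≤ (a+2) ∫G + a⁻¹ ∫‖Dφ‖²` leaves `a ∫G` on the left, which is
  -- the sharp constant `a⁻²`.
  have hda : (d : ℝ) = 2 * a + 2 := by rw [ha]; ring
  rw [hda] at hm
  have : a * ∫ x, G x ≤ a⁻¹ * ∫ x, ‖fderiv ℝ φ x‖ ^ 2 := by linarith
  rw [← div_eq_inv_mul, le_div_iff₀ (by positivity)]
  rw [← div_eq_inv_mul, le_div_iff₀ ha0] at this
  linarith

theorem ofReal_integral_norm_sq_eq {E F : Type*} [MeasurableSpace E] {μ : Measure E}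
    [NormedAddCommGroup F] {f : E → F} (hf : Integrable (fun x => ‖f x‖ ^ 2) μ) :
    ENNReal.ofReal (∫ x, ‖f x‖ ^ 2 ∂μ) = eLpNorm f 2 μ ^ 2 := by
  rw [eLpNorm_two_sq, ofReal_integral_eq_lintegral_ofReal hf (Eventually.of_forall fun x => by positivity)]
  simp [ENNReal.ofReal_pow]

/-- Hardy's inequality. -/
theorem lintegral_hardy_le (hd : 3 ≤ d) (u : H1 d) :
    ∫⁻ x, ‖‖x‖⁻¹ • H1.fn u x‖ₑ ^ 2 ≤
      ENNReal.ofReal ((((d : ℝ) - 2) / 2) ^ 2)⁻¹ * eLpNorm (H1.grad u) 2 volume ^ 2 := by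
  obtain ⟨φ, δ, hφ, hc, hlim, hδ, hb⟩ := exists_testFunction_approx u
  have hcont : ∀ (k : ℕ), Continuous fun x : EuclideanSpace ℝ (Fin d) =>
      ‖φ k x‖ ^ 2 * (‖x‖ ^ 2 + 1 / ((k : ℝ) + 1))⁻¹ := fun k => by
    have := (hφ k).continuous
    refine Continuous.mul (by fun_prop) (Continuous.inv₀ (by fun_prop) fun x => ?_)
    positivity
  have hNZ : Nonempty (Fin d) := ⟨⟨0, by omega⟩⟩
  refine lintegral_le_of_tendsto_ae (F := fun k x => ENNReal.ofReal
      (‖φ k x‖ ^ 2 * (‖x‖ ^ 2 + 1 / ((k : ℝ) + 1))⁻¹)) (a := fun k =>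
      ENNReal.ofReal ((((d : ℝ) - 2) / 2) ^ 2)⁻¹ *
        (eLpNorm (H1.grad u) 2 volume + δ k) ^ 2) ?_ ?_ ?_ ?_
  · intro k
    exact (ENNReal.continuous_ofReal.comp (hcont k)).aemeasurable
  · have h0 : ∀ᵐ x : EuclideanSpace ℝ (Fin d), x ≠ 0 := by
      simp [ae_iff]
    filter_upwards [hlim, h0] with x hx hx0
    have e : ‖‖x‖⁻¹ • H1.fn u x‖ₑ ^ 2 =
        ENNReal.ofReal (‖H1.fn u x‖ ^ 2 * (‖x‖ ^ 2 + 0)⁻¹) := by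
      rw [← ofReal_norm, ← ENNReal.ofReal_pow (norm_nonneg _), norm_smul]
      congr 1
      simp only [norm_inv, norm_norm, add_zero]
      ring
    rw [e]
    refine ENNReal.tendsto_ofReal ((hx.norm.pow 2).mul (Tendsto.inv₀ ?_ (by simpa using hx0)))
    exact tendsto_const_nhds.add tendsto_one_div_add_atTop_nhds_zero_nat
  · intro k
    have hB : Integrable (fun x => ‖fderiv ℝ (φ k) x‖ ^ 2) volume :=
      (((hφ k).continuous_fderiv (by simp)).norm.pow 2).integrable_of_hasCompactSupport
        ((hc k).fderiv ℝ).norm_sq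
    have hA : Integrable (fun x => ‖φ k x‖ ^ 2 * (‖x‖ ^ 2 + 1 / ((k : ℝ) + 1))⁻¹) volume :=
      (hcont k).integrable_of_hasCompactSupport
        (hc k).norm_sq.mul_right
    rw [← ofReal_integral_eq_lintegral_ofReal hA (Eventually.of_forall fun x => by positivity)]
    refine (ENNReal.ofReal_le_ofReal (integral_hardy_testFunction hd (hφ k) (hc k)
      (δ := 1 / ((k : ℝ) + 1)) (by positivity))).trans ?_
    rw [ENNReal.ofReal_mul (by positivity), ofReal_integral_norm_sq_eq hB]
    gcongr
    exact hb k
  · refine ENNReal.Tendsto.const_mul ?_ (Or.inr ENNReal.ofReal_ne_top)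
    have := (tendsto_const_nhds (x := eLpNorm (H1.grad u) 2 volume)).add hδ
    rw [add_zero] at this
    exact ((ENNReal.continuous_pow 2).tendsto _).comp this

/-! ### Sobolev's inequality and translations in `L²` -/

/-- The Sobolev inequality at the critical exponent. -/
theorem exists_lintegral_sobolev_le (hd : 3 ≤ d) :
    ∃ C : NNReal, ∀ u : H1 d, ∫⁻ x, ‖H1.fn u x‖ₑ ^ (2 * d / (d - 2) : ℝ) ≤
      (C * eLpNorm (H1.grad u) 2 volume) ^ (2 * d / (d - 2) : ℝ) := by
  have hd' : (3 : ℝ) ≤ d := by exact_mod_cast hd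
  set q : NNReal := ⟨2 * d / (d - 2), div_nonneg (by positivity) (by linarith)⟩ with hq
  have hqr : (2 * d / (d - 2) : ℝ) = (q : ℝ) := rfl
  have hq0 : 0 < (q : ℝ) := by
    rw [← hqr]
    exact div_pos (by positivity) (by linarith)
  rw [hqr]
  refine ⟨SNormLESNormFDerivOfEqConst ℂ (volume : Measure (EuclideanSpace ℝ (Fin d))) 2,
    fun u => ?_⟩
  set C := SNormLESNormFDerivOfEqConst ℂ (volume : Measure (EuclideanSpace ℝ (Fin d))) 2
  obtain ⟨φ, δ, hφ, hc, hlim, hδ, hb⟩ := exists_testFunction_approx u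
  refine lintegral_le_of_tendsto_ae (F := fun k x => ‖φ k x‖ₑ ^ (q : ℝ)) (a := fun k =>
      (C * (eLpNorm (H1.grad u) 2 volume + δ k)) ^ (q : ℝ)) ?_ ?_ ?_ ?_
  · intro k
    exact (((hφ k).continuous.enorm).measurable.pow_const _).aemeasurable
  · filter_upwards [hlim] with x hx
    exact hx.enorm.ennrpow_const _
  · intro k
    have h1 := eLpNorm_le_eLpNorm_fderiv_of_eq (μ := volume) ((hφ k).of_le (by exact_mod_cast le_top))
      (hc k) (p := 2) (p' := q) (by norm_num) (by simp; omega) (by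
        rw [← hqr, finrank_euclideanSpace_fin]
        have : (d : ℝ) - 2 ≠ 0 := by linarith
        have : (d : ℝ) ≠ 0 := by linarith
        push_cast
        field_simp)
    rw [← eLpNorm_nnreal_pow_eq_lintegral (by exact_mod_cast hq0.ne')]
    exact ENNReal.rpow_le_rpow (h1.trans (mul_le_mul_right (hb k) _)) hq0.le
  · refine Tendsto.ennrpow_const _ (ENNReal.Tendsto.const_mul ?_ (Or.inr ENNReal.coe_ne_top))
    simpa using (tendsto_const_nhds (x := eLpNorm (H1.grad u) 2 volume)).add hδ

/-- The difference is the integral of the derivative along the segment from `x` to `x + h`. Jensen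
in `t`, Tonelli and translation invariance then give the bound. -/
theorem lintegral_translate_testFunction {φ : EuclideanSpace ℝ (Fin d) → ℂ}
    (hφ : ContDiff ℝ (⊤ : ℕ∞) φ) (h : EuclideanSpace ℝ (Fin d)) :
    ∫⁻ x, ‖φ (x + h) - φ x‖ₑ ^ 2 ≤ ‖h‖ₑ ^ 2 * eLpNorm (fderiv ℝ φ) 2 volume ^ 2 := by
  have hD : Continuous (fderiv ℝ φ) := hφ.continuous_fderiv (by simp)
  have hline : ∀ x, φ (x + h) - φ x = ∫ t in (0 : ℝ)..1, fderiv ℝ φ (x + t • h) h := by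
    intro x
    have := intervalIntegral.integral_eq_sub_of_hasDerivAt (a := 0) (b := 1)
      (f := fun t : ℝ => φ (x + t • h)) (f' := fun t => fderiv ℝ φ (x + t • h) h)
      (fun t _ => ?_) (Continuous.intervalIntegrable (by fun_prop) _ _)
    · simpa using this.symm
    · show HasDerivAt (φ ∘ fun t : ℝ => x + t • h) _ t
      have h1 := ((hφ.differentiable (by simp)) (x + t • h)).hasFDerivAt.comp_hasDerivAt t
        (((hasDerivAt_id t).smul_const h).const_add x)
      simpa using h1
  have hpt : ∀ x, ‖φ (x + h) - φ x‖ₑ ^ 2 ≤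
      ∫⁻ t in Set.Ioc (0 : ℝ) 1, (‖fderiv ℝ φ (x + t • h)‖ₑ * ‖h‖ₑ) ^ 2 := by
    intro x
    rw [hline, intervalIntegral.integral_of_le zero_le_one]
    have h1 : ‖∫ t in Set.Ioc (0 : ℝ) 1, fderiv ℝ φ (x + t • h) h‖ₑ ≤
        ∫⁻ t in Set.Ioc (0 : ℝ) 1, 1 * (‖fderiv ℝ φ (x + t • h)‖ₑ * ‖h‖ₑ) := by
      refine (enorm_integral_le_lintegral_enorm _).trans ?_
      simp only [one_mul]
      gcongr with t
      exact (fderiv ℝ φ (x + t • h)).le_opENorm h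
    have hm : Continuous fun t : ℝ => fderiv ℝ φ (x + t • h) := by fun_prop
    refine (pow_le_pow_left' h1 2).trans ((lintegral_mul_sq_le (by fun_prop)
      (hm.enorm.measurable.mul_const _).aemeasurable).trans ?_)
    simp
  have hm2 : Continuous (Function.uncurry fun x (t : ℝ) => fderiv ℝ φ (x + t • h)) := by
    fun_prop
  calc ∫⁻ x, ‖φ (x + h) - φ x‖ₑ ^ 2
      ≤ ∫⁻ x, ∫⁻ t in Set.Ioc (0 : ℝ) 1, (‖fderiv ℝ φ (x + t • h)‖ₑ * ‖h‖ₑ) ^ 2 :=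
        lintegral_mono hpt
    _ = ∫⁻ t in Set.Ioc (0 : ℝ) 1, ∫⁻ x, (‖fderiv ℝ φ (x + t • h)‖ₑ * ‖h‖ₑ) ^ 2 :=
        lintegral_lintegral_swap (hm2.enorm.measurable.mul_const _ |>.pow_const 2).aemeasurable
    _ = ∫⁻ t in Set.Ioc (0 : ℝ) 1, ∫⁻ x, (‖fderiv ℝ φ x‖ₑ * ‖h‖ₑ) ^ 2 := by
        congr with t
        exact lintegral_add_right_eq_self (fun x => (‖fderiv ℝ φ x‖ₑ * ‖h‖ₑ) ^ 2) (t • h)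
    _ = ‖h‖ₑ ^ 2 * eLpNorm (fderiv ℝ φ) 2 volume ^ 2 := by
        simp only [mul_pow, eLpNorm_two_sq]
        rw [lintegral_mul_const _ (hD.enorm.measurable.pow_const 2)]
        simp [mul_comm]

theorem lintegral_translate_le (u : H1 d) (h : EuclideanSpace ℝ (Fin d)) :
    ∫⁻ x, ‖H1.fn u (x + h) - H1.fn u x‖ₑ ^ 2 ≤
      ‖h‖ₑ ^ 2 * eLpNorm (H1.grad u) 2 volume ^ 2 := by
  obtain ⟨φ, δ, hφ, hc, hlim, hδ, hb⟩ := exists_testFunction_approx u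
  refine lintegral_le_of_tendsto_ae (F := fun k x => ‖φ k (x + h) - φ k x‖ₑ ^ 2) (a := fun k =>
      ‖h‖ₑ ^ 2 * (eLpNorm (H1.grad u) 2 volume + δ k) ^ 2) ?_ ?_ ?_ ?_
  · intro k
    have := (hφ k).continuous
    exact Continuous.aemeasurable (by fun_prop)
  · have h2 := (measurePreserving_add_right volume h).quasiMeasurePreserving.ae hlim
    filter_upwards [hlim, h2] with x hx hx2
    exact ((ENNReal.continuous_pow 2).tendsto _).comp (hx2.sub hx).enorm
  · intro k
    refine (lintegral_translate_testFunction (hφ k) h).trans ?_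
    gcongr
    exact hb k
  · refine ENNReal.Tendsto.const_mul ?_ (Or.inr (by simp))
    have := (tendsto_const_nhds (x := eLpNorm (H1.grad u) 2 volume)).add hδ
    rw [add_zero] at this
    exact ((ENNReal.continuous_pow 2).tendsto _).comp this

/-! ### Interpolation bounds for the potential -/

/-- `∫_A |x|^{-b} |u|^{σ+2} dx` with values in `[0, ∞]`. -/
def lpotential (b σ : ℝ) (A : Set (EuclideanSpace ℝ (Fin d))) (u : H1 d) : ℝ≥0∞ :=
  ∫⁻ x in A, ENNReal.ofReal (‖x‖ ^ (-b)) * ‖H1.fn u x‖ₑ ^ (σ + 2)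

theorem stronglyMeasurable_fn (u : H1 d) : StronglyMeasurable (H1.fn u) :=
  Lp.stronglyMeasurable _

theorem eLpNorm_fn_le (u : H1 d) : eLpNorm (H1.fn u) 2 volume ≤ ‖u‖ₑ := by
  have h : ‖u.1.fst‖ ≤ ‖u‖ := WithLp.norm_fst_le _ u.1
  rw [H1.fn, ← Lp.enorm_def]
  exact enorm_le_iff_norm_le.2 h

theorem eLpNorm_grad_le (u : H1 d) : eLpNorm (H1.grad u) 2 volume ≤ ‖u‖ₑ := by
  have h : ‖u.1.snd‖ ≤ ‖u‖ := WithLp.norm_snd_le _ u.1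
  rw [H1.grad, ← Lp.enorm_def]
  exact enorm_le_iff_norm_le.2 h

/-- Hölder with three factors: `|x|^(-b) |u|^(σ+2) = (|x|⁻¹|u|)^b · |u|^(2α) · |u|^(qβ)`. The set
`A` is kept on the `L²` factor only, since that is the factor which becomes small on balls along
weakly null sequences. -/
theorem lpotential_le_mul {b σ α β q : ℝ} (hb : 0 ≤ b) (hα : 0 ≤ α) (hβ : 0 ≤ β) (hq : 0 ≤ q)
    (h1 : b / 2 + α + β = 1) (h2 : b + 2 * α + q * β = σ + 2)
    (A : Set (EuclideanSpace ℝ (Fin d))) (u : H1 d) :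
    lpotential b σ A u ≤ (∫⁻ x, ‖‖x‖⁻¹ • H1.fn u x‖ₑ ^ 2) ^ (b / 2) *
      (∫⁻ x in A, ‖H1.fn u x‖ₑ ^ 2) ^ α * (∫⁻ x, ‖H1.fn u x‖ₑ ^ q) ^ β := by
  have hu := (stronglyMeasurable_fn u).measurable
  have h := ENNReal.lintegral_prod_norm_pow_le (μ := volume.restrict A) (Finset.univ : Finset (Fin 3))
    (f := ![fun x => ‖‖x‖⁻¹ • H1.fn u x‖ₑ ^ 2, fun x => ‖H1.fn u x‖ₑ ^ 2,
      fun x => ‖H1.fn u x‖ₑ ^ q]) (p := ![b / 2, α, β]) (by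
        intro i _
        fin_cases i
        · exact Measurable.aemeasurable (by dsimp; fun_prop)
        · exact Measurable.aemeasurable (by dsimp; fun_prop)
        · exact Measurable.aemeasurable (by dsimp; fun_prop))
      (by simp [Fin.sum_univ_three, h1])
      (by
        intro i _
        fin_cases i
        · exact div_nonneg hb (by norm_num)
        · exact hα
        · exact hβ)
  simp only [Fin.prod_univ_three, Matrix.cons_val_zero, Matrix.cons_val_one, Matrix.cons_val] at h
  have hpt : ∀ x : EuclideanSpace ℝ (Fin d),
      (‖‖x‖⁻¹ • H1.fn u x‖ₑ ^ 2) ^ (b / 2) * (‖H1.fn u x‖ₑ ^ 2) ^ α * (‖H1.fn u x‖ₑ ^ q) ^ β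
        = ENNReal.ofReal (‖x‖ ^ (-b)) * ‖H1.fn u x‖ₑ ^ (σ + 2) := by
    intro x
    have e1 : ‖x‖ ^ (-b) = (‖x‖⁻¹) ^ b := by
      rw [Real.rpow_neg (norm_nonneg _), Real.inv_rpow (norm_nonneg _)]
    rw [e1, ← ENNReal.ofReal_rpow_of_nonneg (by positivity) hb, enorm_smul,
      Real.enorm_of_nonneg (by positivity : 0 ≤ ‖x‖⁻¹), ← h2,
      ENNReal.rpow_add_of_nonneg _ _ (by positivity) (by positivity),
      ENNReal.rpow_add_of_nonneg _ _ (by positivity) (by positivity), mul_pow,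
      ENNReal.mul_rpow_of_nonneg _ _ (by positivity)]
    simp only [← ENNReal.rpow_two, ← ENNReal.rpow_mul]
    rw [show 2 * (b / 2) = b by ring]
    simp only [mul_assoc]
  simp only [hpt] at h
  refine h.trans ?_
  gcongr
  · exact Measure.restrict_le_self
  · exact Measure.restrict_le_self

/-- Weighted interpolation between the Hardy and the Sobolev inequality. -/
theorem exists_lpotential_le (hd : 3 ≤ d) {b σ : ℝ} (hb : 0 ≤ b) (hσ : 0 ≤ σ)
    (hσ2 : σ < (4 - 2 * b) / ((d : ℝ) - 2)) :
    ∃ (K : NNReal) (α : ℝ), 0 < α ∧ 2 * α ≤ σ + 2 ∧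
      ∀ (A : Set (EuclideanSpace ℝ (Fin d))) (u : H1 d),
        lpotential b σ A u ≤ K * ‖u‖ₑ ^ (σ + 2 - 2 * α) * (∫⁻ x in A, ‖H1.fn u x‖ₑ ^ 2) ^ α := by
  obtain ⟨C, hC⟩ := exists_lintegral_sobolev_le hd
  have hd' : (3 : ℝ) ≤ d := by exact_mod_cast hd
  have hd2 : 0 < (d : ℝ) - 2 := by linarith
  rw [lt_div_iff₀ hd2] at hσ2
  set q : ℝ := 2 * d / (d - 2) with hq
  have hq0 : 0 ≤ q := div_nonneg (by positivity) hd2.le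
  -- The two exponent equations give `(q - 2) β = σ`, and `q - 2 = 4/(d-2)`.
  set β : ℝ := σ * (d - 2) / 4 with hβ
  have hβ0 : 0 ≤ β := by positivity
  have hqβ : q * β = d * σ / 2 := by
    rw [hq, hβ]
    field_simp
    ring
  set α : ℝ := 1 - b / 2 - β with hα
  -- Positivity of `α` is exactly the subcriticality `σ (d-2) < 4 - 2b`.
  have hα0 : 0 < α := by rw [hα, hβ]; linarith
  have h2 : b + 2 * α + q * β = σ + 2 := by
    rw [hqβ, hα, hβ]; ring
  set H : ℝ≥0∞ := ENNReal.ofReal ((((d : ℝ) - 2) / 2) ^ 2)⁻¹ with hH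
  refine ⟨(H ^ (b / 2) * (C : ℝ≥0∞) ^ (q * β)).toNNReal, α, hα0, ?_, fun A u => ?_⟩
  · have := mul_nonneg hq0 hβ0
    linarith
  have hKfin : H ^ (b / 2) * (C : ℝ≥0∞) ^ (q * β) ≠ ∞ :=
    ENNReal.mul_ne_top (ENNReal.rpow_ne_top_of_nonneg (by positivity) ENNReal.ofReal_ne_top)
      (ENNReal.rpow_ne_top_of_nonneg (by positivity) ENNReal.coe_ne_top)
  rw [ENNReal.coe_toNNReal hKfin]
  have hg := eLpNorm_grad_le u
  calc lpotential b σ A u ≤ _ :=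
        lpotential_le_mul hb hα0.le hβ0 hq0 (by rw [hα]; ring) h2 A u
    _ ≤ (H * ‖u‖ₑ ^ 2) ^ (b / 2) * (∫⁻ x in A, ‖H1.fn u x‖ₑ ^ 2) ^ α *
          ((C * ‖u‖ₑ) ^ q) ^ β := by
        gcongr
        · exact (lintegral_hardy_le hd u).trans (by gcongr)
        · exact (hC u).trans (by gcongr)
    _ = _ := by
        rw [← ENNReal.rpow_mul, ENNReal.mul_rpow_of_nonneg _ _ (by positivity),
          ENNReal.mul_rpow_of_nonneg _ _ (by positivity), ← ENNReal.rpow_two, ← ENNReal.rpow_mul,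
          show 2 * (b / 2) = b by ring, show σ + 2 - 2 * α = b + q * β by linarith,
          ENNReal.rpow_add_of_nonneg _ _ (by positivity) (by positivity)]
        ring

theorem exists_lpotential_univ_le (hd : 3 ≤ d) {b σ : ℝ} (hb : 0 ≤ b) (hσ : 0 ≤ σ)
    (hσ2 : σ < (4 - 2 * b) / ((d : ℝ) - 2)) :
    ∃ K : NNReal, ∀ (u : H1 d) , lpotential b σ Set.univ u ≤ K * ‖u‖ₑ ^ (σ + 2) := by
  obtain ⟨K, α, hα, hα2, h⟩ := exists_lpotential_le hd hb hσ hσ2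
  refine ⟨K, fun u => (h _ u).trans ?_⟩
  calc K * ‖u‖ₑ ^ (σ + 2 - 2 * α) * (∫⁻ x in Set.univ, ‖H1.fn u x‖ₑ ^ 2) ^ α
      ≤ K * ‖u‖ₑ ^ (σ + 2 - 2 * α) * (‖u‖ₑ ^ 2) ^ α := by
        gcongr
        rw [Measure.restrict_univ, ← eLpNorm_two_sq]
        gcongr
        exact eLpNorm_fn_le u
    _ = K * ‖u‖ₑ ^ (σ + 2) := by
        rw [mul_assoc, ← ENNReal.rpow_two, ← ENNReal.rpow_mul,
          ← ENNReal.rpow_add_of_nonneg _ _ (by linarith) (by linarith), sub_add_cancel]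

/-! ### The quadratic part: Hilbert space form, derivative, coercivity -/

/-- The embedding `H¹ → L²`. -/
def valL (d : ℕ) : H1 d →L[ℝ] L2 d ℂ :=
  ((WithLp.fstL 2 ℂ (L2 d ℂ) (L2 d (EuclideanSpace ℂ (Fin d)))).comp
    (H1 d).subtypeL).restrictScalars ℝ

/-- The weak gradient as a map `H¹ → L²`. -/
def gradL (d : ℕ) : H1 d →L[ℝ] L2 d (EuclideanSpace ℂ (Fin d)) :=
  ((WithLp.sndL 2 ℂ (L2 d ℂ) (L2 d (EuclideanSpace ℂ (Fin d)))).comp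
    (H1 d).subtypeL).restrictScalars ℝ

theorem gradL_apply (u : H1 d) : gradL d u = u.1.snd := rfl

theorem norm_sq_eq (u : H1 d) : ‖u‖ ^ 2 = ‖valL d u‖ ^ 2 + ‖gradL d u‖ ^ 2 :=
  WithLp.prod_norm_sq_eq_of_L2 u.1

theorem fn_add (u v : H1 d) : H1.fn (u + v) =ᵐ[volume] fun x => H1.fn u x + H1.fn v x :=
  Lp.coeFn_add u.1.fst v.1.fst

theorem fn_sub (u v : H1 d) : H1.fn (u - v) =ᵐ[volume] fun x => H1.fn u x - H1.fn v x :=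
  Lp.coeFn_sub u.1.fst v.1.fst

theorem fn_smul (t : ℝ) (u : H1 d) : H1.fn (t • u) =ᵐ[volume] fun x => t • H1.fn u x :=
  Lp.coeFn_smul t u.1.fst

theorem aestronglyMeasurable_hardyWeight_smul (u : H1 d) : AEStronglyMeasurable
    (fun x : EuclideanSpace ℝ (Fin d) => ‖x‖⁻¹ • H1.fn u x) volume := by
  have := (stronglyMeasurable_fn u).measurable
  exact Measurable.aestronglyMeasurable (by fun_prop)

theorem memLp_hardyWeight_smul (hd : 3 ≤ d) (u : H1 d) :
    MemLp (fun x : EuclideanSpace ℝ (Fin d) => ‖x‖⁻¹ • H1.fn u x) 2 volume := by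
  refine ⟨aestronglyMeasurable_hardyWeight_smul u, ?_⟩
  have h := lintegral_hardy_le hd u
  rw [← eLpNorm_two_sq] at h
  have h2 : eLpNorm (fun x : EuclideanSpace ℝ (Fin d) => ‖x‖⁻¹ • H1.fn u x) 2 volume ^ 2 < ∞ :=
    h.trans_lt (ENNReal.mul_lt_top ENNReal.ofReal_lt_top
      (ENNReal.pow_lt_top (Lp.memLp u.1.snd).eLpNorm_lt_top))
  exact (ENNReal.pow_lt_top_iff.1 h2).resolve_right two_ne_zero

theorem norm_sq_eq_integral {F : Type} [NormedAddCommGroup F] (f : L2 d F) :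
    ‖f‖ ^ 2 = ∫ x, ‖f x‖ ^ 2 := by
  have h : ENNReal.ofReal (∫ x, ‖f x‖ ^ 2) = ENNReal.ofReal (‖f‖ ^ 2) := by
    rw [ofReal_integral_norm_sq_eq ((memLp_two_iff_integrable_sq_norm (Lp.memLp f).1).1 (Lp.memLp f)),
      ENNReal.ofReal_pow (norm_nonneg _), ofReal_norm, Lp.enorm_def]
  exact ((ENNReal.ofReal_eq_ofReal_iff (integral_nonneg fun x => by positivity)
    (by positivity)).1 h).symm

theorem norm_toLp_hardyWeight_sq_le (hd : 3 ≤ d) (u : H1 d) :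
    ‖(memLp_hardyWeight_smul hd u).toLp‖ ^ 2 ≤
      ((((d : ℝ) - 2) / 2) ^ 2)⁻¹ * ‖gradL d u‖ ^ 2 := by
  have h := lintegral_hardy_le hd u
  rw [← eLpNorm_two_sq] at h
  have hfin := (Lp.memLp u.1.snd).eLpNorm_ne_top
  rw [Lp.norm_toLp, gradL_apply, Lp.norm_def, ← ENNReal.toReal_pow, ← ENNReal.toReal_pow]
  rw [← ENNReal.toReal_ofReal (by positivity : 0 ≤ ((((d : ℝ) - 2) / 2) ^ 2)⁻¹),
    ← ENNReal.toReal_mul]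
  exact ENNReal.toReal_mono (ENNReal.mul_ne_top ENNReal.ofReal_ne_top
    (ENNReal.pow_ne_top hfin)) h

/-- The map `u ↦ |x|⁻¹ u` from `H¹` to `L²`. -/
def hardyL (hd : 3 ≤ d) : H1 d →L[ℝ] L2 d ℂ :=
  LinearMap.mkContinuous
    { toFun := fun u => (memLp_hardyWeight_smul hd u).toLp
      map_add' := by
        intro u v
        rw [← MemLp.toLp_add]
        apply MemLp.toLp_congr
        filter_upwards [fn_add u v] with x hx
        simp [hx]
      map_smul' := by
        intro t u
        rw [RingHom.id_apply, ← MemLp.toLp_const_smul]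
        apply MemLp.toLp_congr
        filter_upwards [fn_smul t u] with x hx
        simp only [hx, Pi.smul_apply]
        rw [smul_comm] }
    (Real.sqrt ((((d : ℝ) - 2) / 2) ^ 2)⁻¹) (by
      intro u
      refine abs_le_of_sq_le_sq' ?_ (by positivity) |>.2
      rw [mul_pow, Real.sq_sqrt (by positivity)]
      refine (norm_toLp_hardyWeight_sq_le hd u).trans ?_
      gcongr
      exact WithLp.norm_snd_le _ u.1)

theorem norm_hardyL_sq_le (hd : 3 ≤ d) (u : H1 d) :
    (((d : ℝ) - 2) / 2) ^ 2 * ‖hardyL hd u‖ ^ 2 ≤ ‖gradL d u‖ ^ 2 := by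
  have hd' : (3 : ℝ) ≤ d := by exact_mod_cast hd
  have h0 : 0 < (((d : ℝ) - 2) / 2) ^ 2 := by
    have : 0 < ((d : ℝ) - 2) / 2 := by linarith
    positivity
  have h : ‖hardyL hd u‖ ^ 2 ≤ _ := norm_toLp_hardyWeight_sq_le hd u
  rwa [← div_eq_inv_mul, le_div_iff₀ h0, mul_comm] at h

theorem mass_eq (u : H1 d) : mass u = ‖valL d u‖ ^ 2 := (norm_sq_eq_integral _).symm

theorem hardy_eq (hd : 3 ≤ d) (c : ℝ) (u : H1 d) :
    hardy c u = ‖gradL d u‖ ^ 2 - c * ‖hardyL hd u‖ ^ 2 := by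
  rw [hardy, gradL_apply, norm_sq_eq_integral, norm_sq_eq_integral]
  congr 2
  refine integral_congr_ae ?_
  have h : hardyL hd u =ᵐ[volume] _ := (memLp_hardyWeight_smul hd u).coeFn_toLp
  filter_upwards [h] with x hx
  rw [hx, norm_smul]
  simp

/-- The quadratic part of the Nehari functional. -/
def quad (c ω : ℝ) (u : H1 d) : ℝ := hardy c u + ω * mass u

theorem quad_eq (hd : 3 ≤ d) (c ω : ℝ) (u : H1 d) :
    quad c ω u = ‖gradL d u‖ ^ 2 - c * ‖hardyL hd u‖ ^ 2 + ω * ‖valL d u‖ ^ 2 := by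
  rw [quad, hardy_eq hd, mass_eq]

theorem quad_smul (hd : 3 ≤ d) (c ω t : ℝ) (u : H1 d) : quad c ω (t • u) = t ^ 2 * quad c ω u := by
  simp only [quad_eq hd, map_smul, norm_smul, mul_pow, Real.norm_eq_abs, sq_abs]
  ring

/-- The derivative of the quadratic part. -/
def quadDeriv (hd : 3 ≤ d) (c ω : ℝ) (u : H1 d) : H1 d →L[ℝ] ℝ :=
  (2 : ℝ) • ((innerSL ℝ (gradL d u)).comp (gradL d)
    - c • (innerSL ℝ (hardyL hd u)).comp (hardyL hd) + ω • (innerSL ℝ (valL d u)).comp (valL d))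

theorem quad_add (hd : 3 ≤ d) (c ω : ℝ) (u v : H1 d) :
    quad c ω (u + v) = quad c ω u + quadDeriv hd c ω u v + quad c ω v := by
  simp only [quad_eq hd, map_add, norm_add_sq_real, quadDeriv, add_apply, smul_apply,
    sub_apply, ContinuousLinearMap.comp_apply, innerSL_apply_apply, smul_eq_mul]
  ring

theorem hasFDerivAt_quad (hd : 3 ≤ d) (c ω : ℝ) (u : H1 d) :
    HasFDerivAt (quad c ω) (quadDeriv hd c ω u) u := by
  have h1 := (gradL d).hasFDerivAt (x := u) |>.norm_sq
  have h2 := (hardyL hd).hasFDerivAt (x := u) |>.norm_sq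
  have h3 := (valL d).hasFDerivAt (x := u) |>.norm_sq
  have h := (h1.sub (h2.const_mul c)).add (h3.const_mul ω)
  have e : quad (d := d) c ω = fun u => ‖gradL d u‖ ^ 2 - c * ‖hardyL hd u‖ ^ 2 +
    ω * ‖valL d u‖ ^ 2 := funext (quad_eq hd c ω)
  rw [e]
  refine h.congr_fderiv ?_
  ext v
  simp [quadDeriv]
  ring

/-- For `c ≥ 0` Hardy's inequality absorbs the singular term and leaves the fraction `1 - c/C` of
the gradient; for `c ≤ 0` that term already has the good sign. -/
theorem exists_le_quad (hd : 3 ≤ d) {c ω : ℝ} (hω : 0 < ω) (hcd : c < (((d : ℝ) - 2) / 2) ^ 2) :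
    ∃ κ : ℝ, 0 < κ ∧ ∀ u : H1 d, κ * ‖u‖ ^ 2 ≤ quad c ω u := by
  set C := (((d : ℝ) - 2) / 2) ^ 2 with hC
  have hd' : (3 : ℝ) ≤ d := by exact_mod_cast hd
  have h0 : 0 < C := by
    have : 0 < ((d : ℝ) - 2) / 2 := by linarith
    positivity
  have hκ : 0 < min 1 (1 - c / C) := lt_min one_pos (by rw [sub_pos, div_lt_one h0]; exact hcd)
  refine ⟨min (min 1 (1 - c / C)) ω, lt_min hκ hω, fun u => ?_⟩
  rw [quad_eq hd, norm_sq_eq]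
  have hH := norm_hardyL_sq_le hd u
  rw [← hC] at hH
  have h1 : min 1 (1 - c / C) * ‖gradL d u‖ ^ 2 ≤ ‖gradL d u‖ ^ 2 - c * ‖hardyL hd u‖ ^ 2 := by
    rcases le_total c 0 with hc | hc
    · have := mul_nonneg (neg_nonneg.2 hc) (sq_nonneg ‖hardyL hd u‖)
      have := mul_le_mul_of_nonneg_right (min_le_left 1 (1 - c / C)) (sq_nonneg ‖gradL d u‖)
      linarith
    · have h2 := mul_le_mul_of_nonneg_right (min_le_right 1 (1 - c / C)) (sq_nonneg ‖gradL d u‖)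
      have h3 := mul_le_mul_of_nonneg_left hH (div_nonneg hc h0.le)
      have h4 : c / C * (C * ‖hardyL hd u‖ ^ 2) = c * ‖hardyL hd u‖ ^ 2 := by
        field_simp
      linarith
  have h5 := mul_le_mul_of_nonneg_right (min_le_left (min 1 (1 - c / C)) ω) (sq_nonneg ‖gradL d u‖)
  have h6 := mul_le_mul_of_nonneg_right (min_le_right (min 1 (1 - c / C)) ω) (sq_nonneg ‖valL d u‖)
  linarith

/-! ### Completeness and weak compactness of `H¹` -/

/-- Integration against a square-integrable real function. -/
theorem exists_clm_eq_integral_smul {F : Type} [NormedAddCommGroup F] [NormedSpace ℝ F]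
    [CompleteSpace F] {ψ : EuclideanSpace ℝ (Fin d) → ℝ} (hψ : MemLp ψ 2 volume) :
    ∃ Λ : L2 d F →L[ℝ] F, ∀ f : L2 d F, Λ f = ∫ x, ψ x • f x := by
  refine ⟨(ContinuousLinearMap.lsmul ℝ ℝ : ℝ →L[ℝ] F →L[ℝ] F).lpPairing volume 2 2 hψ.toLp,
    fun f => ?_⟩
  rw [ContinuousLinearMap.lpPairing_eq_integral]
  refine integral_congr_ae ?_
  filter_upwards [hψ.coeFn_toLp] with x hx
  simp [hx]

theorem integral_smul_apply {ψ : EuclideanSpace ℝ (Fin d) → ℝ} (hψ : MemLp ψ 2 volume)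
    (g : L2 d (EuclideanSpace ℂ (Fin d))) (i : Fin d) :
    ∫ x, ψ x • g x i = (∫ x, ψ x • g x) i := by
  have := ((EuclideanSpace.proj i : EuclideanSpace ℂ (Fin d) →L[ℂ] ℂ).restrictScalars
    ℝ).integral_comp_comm (integrable_test_smul hψ (Lp.memLp g))
  simpa using this

/-- For each test function and direction, both sides of the weak gradient identity are continuous on
`L² × L²`. -/
theorem isClosed_H1 (d : ℕ) : IsClosed (H1 d : Set (WithLp 2
    (L2 d ℂ × L2 d (EuclideanSpace ℂ (Fin d))))) := by
  have e : (H1 d : Set (WithLp 2 (L2 d ℂ × L2 d (EuclideanSpace ℂ (Fin d))))) =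
      ⋂ (φ : EuclideanSpace ℝ (Fin d) → ℝ) (_ : ContDiff ℝ (⊤ : ℕ∞) φ) (_ : HasCompactSupport φ)
        (i : Fin d), {p | ∫ x, fderiv ℝ φ x (EuclideanSpace.single i 1) • p.fst x
          = - ∫ x, φ x • p.snd x i} := by
    ext p
    simp only [Set.mem_iInter]
    rfl
  rw [e]
  refine isClosed_iInter fun φ => isClosed_iInter fun hφ => isClosed_iInter fun hc =>
    isClosed_iInter fun i => ?_
  have h1 := memLp_partial hφ hc (EuclideanSpace.single i 1)
  have h2 := memLp_test hφ.continuous hc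
  obtain ⟨Λ, hΛ⟩ := exists_clm_eq_integral_smul (F := ℂ) h1
  obtain ⟨Λ', hΛ'⟩ := exists_clm_eq_integral_smul (F := EuclideanSpace ℂ (Fin d)) h2
  simp only [integral_smul_apply h2, ← hΛ, ← hΛ']
  refine isClosed_eq ?_ ?_
  · exact Λ.continuous.comp (WithLp.continuous_fst _ _ _)
  · have : Continuous fun p : WithLp 2 (L2 d ℂ × L2 d (EuclideanSpace ℂ (Fin d))) => Λ' p.snd :=
      Λ'.continuous.comp (WithLp.continuous_snd _ _ _)
    fun_prop

instance : CompleteSpace (H1 d) := (isClosed_H1 d).completeSpace_coe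

/-- Bounded sequences in a separable Hilbert space have weakly convergent subsequences. -/
theorem exists_subseq_tendsto_weak {E : Type*} [NormedAddCommGroup E] [InnerProductSpace ℂ E]
    [CompleteSpace E] [TopologicalSpace.SeparableSpace E] {u : ℕ → E} {R : ℝ}
    (hu : ∀ n, ‖u n‖ ≤ R) :
    ∃ (v : E) (φ : ℕ → ℕ), StrictMono φ ∧
      ∀ f : E →L[ℂ] ℂ, Tendsto (fun n => f (u (φ n))) atTop (𝓝 (f v)) := by
  -- Sequential Banach–Alaoglu in the dual, transported by the Riesz isomorphism. That map is
  -- conjugate linear, hence the conjugations below.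
  obtain ⟨w, -, φ, hφ, hw⟩ := WeakDual.isSeqCompact_closedBall ℂ E 0 R
    (x := fun n => StrongDual.toWeakDual (InnerProductSpace.toDual ℂ E (u n))) (by
      intro n
      simpa using hu n)
  refine ⟨(InnerProductSpace.toDual ℂ E).symm (WeakDual.toStrongDual w), φ, hφ, fun f => ?_⟩
  set z := (InnerProductSpace.toDual ℂ E).symm f with hz
  have h1 := (WeakBilin.eval_continuous (topDualPairing ℂ E) z).tendsto w |>.comp hw
  have h2 := (Complex.continuous_conj.tendsto _).comp h1
  have hf : ∀ x, f x = starRingEnd ℂ (inner ℂ x z) := by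
    intro x
    rw [inner_conj_symm, hz, InnerProductSpace.toDual_symm_apply]
  have e2 : f ((InnerProductSpace.toDual ℂ E).symm (WeakDual.toStrongDual w)) =
      starRingEnd ℂ (w z) := by
    rw [hf, InnerProductSpace.toDual_symm_apply]
    rfl
  rw [e2]
  simp only [hf]
  exact h2

instance (F : Type) [NormedAddCommGroup F] [TopologicalSpace.SeparableSpace F] :
    SecondCountableTopology (L2 d F) :=
  haveI : Fact ((2 : ℝ≥0∞) ≠ ∞) := ⟨ENNReal.ofNat_ne_top⟩
  Lp.SecondCountableTopology

instance : SecondCountableTopology (WithLp 2 (L2 d ℂ × L2 d (EuclideanSpace ℂ (Fin d)))) :=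
  WithLp.secondCountableTopology 2 (L2 d ℂ) (L2 d (EuclideanSpace ℂ (Fin d)))

instance : TopologicalSpace.SeparableSpace (H1 d) :=
  haveI : SecondCountableTopology (H1 d) := TopologicalSpace.Subtype.secondCountableTopology _
  inferInstance

/-- A real functional is the real part of a complex one. The real form is needed because the
derivatives of real functionals are only real linear. -/
theorem exists_subseq_tendsto_weak_real {u : ℕ → H1 d} {R : ℝ} (hu : ∀ n, ‖u n‖ ≤ R) :
    ∃ (v : H1 d) (φ : ℕ → ℕ), StrictMono φ ∧
      ∀ f : H1 d →L[ℝ] ℝ, Tendsto (fun n => f (u (φ n))) atTop (𝓝 (f v)) := by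
  obtain ⟨v, φ, hφ, h⟩ := exists_subseq_tendsto_weak hu
  refine ⟨v, φ, hφ, fun f => ?_⟩
  have h1 := (Complex.continuous_re.tendsto _).comp (h (StrongDual.extendRCLike f))
  have e : ∀ x, (StrongDual.extendRCLike f x : ℂ).re = f x := fun x => by
    rw [← RCLike.re_eq_complex_re]
    exact StrongDual.re_extendRCLike_apply f x
  simpa only [Function.comp_def, e] using h1

/-! ### The local Rellich theorem -/

/-- Jensen for the weight `η`, Tonelli, and the translation estimate for shifts in the support of
`η`. The error is uniform on bounded subsets of `H¹`. -/
theorem eLpNorm_mollify_sub_le (η : ContDiffBump (0 : EuclideanSpace ℝ (Fin d))) (u : H1 d) :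
    eLpNorm (fun x => mollify η (H1.fn u) x - H1.fn u x) 2 volume ≤
      ENNReal.ofReal η.rOut * eLpNorm (H1.grad u) 2 volume := by
  have hlu : LocallyIntegrable (H1.fn u) volume := locallyIntegrable_lp _
  have hu := (stronglyMeasurable_fn u).measurable
  have hη := (η.continuous_normed (μ := volume)).measurable
  have hη1 : ∫⁻ t, ‖η.normed volume t‖ₑ = 1 := by
    have : ∀ x, ‖η.normed volume x‖ₑ = ENNReal.ofReal (η.normed volume x) :=
      fun x => Real.enorm_of_nonneg (η.nonneg_normed x)
    simp only [this]
    rw [← ofReal_integral_eq_lintegral_ofReal η.integrable_normed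
      (Eventually.of_forall η.nonneg_normed), η.integral_normed, ofReal_one]
  rw [← ENNReal.pow_le_pow_left_iff (two_ne_zero), eLpNorm_two_sq, mul_pow]
  have hpt : ∀ x, ‖mollify η (H1.fn u) x - H1.fn u x‖ₑ ^ 2 ≤
      ∫⁻ t, ‖η.normed volume t‖ₑ * ‖H1.fn u (x - t) - H1.fn u x‖ₑ ^ 2 := by
    intro x
    have hint : Integrable (fun t => η.normed volume t • H1.fn u (x - t)) volume :=
      (η.hasCompactSupport_normed (μ := volume)).convolutionExists_left
        (ContinuousLinearMap.lsmul ℝ ℝ) η.continuous_normed hlu x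
    have e : mollify η (H1.fn u) x - H1.fn u x =
        ∫ t, η.normed volume t • (H1.fn u (x - t) - H1.fn u x) := by
      simp only [smul_sub]
      rw [integral_sub hint (η.integrable_normed.smul_const _), integral_smul_const,
        η.integral_normed, one_smul, mollify_eq_convolution]
      rfl
    rw [e]
    refine (pow_le_pow_left' (enorm_integral_le_lintegral_enorm _) 2).trans ?_
    simp only [enorm_smul]
    refine (lintegral_mul_sq_le (by fun_prop) (by fun_prop)).trans ?_
    rw [hη1, one_mul]
  calc ∫⁻ x, ‖mollify η (H1.fn u) x - H1.fn u x‖ₑ ^ 2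
      ≤ ∫⁻ x, ∫⁻ t, ‖η.normed volume t‖ₑ * ‖H1.fn u (x - t) - H1.fn u x‖ₑ ^ 2 :=
        lintegral_mono hpt
    _ = ∫⁻ t, ∫⁻ x, ‖η.normed volume t‖ₑ * ‖H1.fn u (x - t) - H1.fn u x‖ₑ ^ 2 :=
        lintegral_lintegral_swap (by fun_prop)
    _ ≤ ∫⁻ t, ‖η.normed volume t‖ₑ *
          (ENNReal.ofReal η.rOut ^ 2 * eLpNorm (H1.grad u) 2 volume ^ 2) := by
        refine lintegral_mono fun t => ?_
        rw [lintegral_const_mul _ (by fun_prop)]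
        by_cases ht : t ∈ Metric.ball (0 : EuclideanSpace ℝ (Fin d)) η.rOut
        · refine mul_le_mul_right ?_ _
          have h := lintegral_translate_le u (-t)
          simp only [← sub_eq_add_neg, enorm_neg] at h
          refine h.trans ?_
          gcongr
          rw [← ofReal_norm]
          exact ENNReal.ofReal_le_ofReal (mem_ball_zero_iff.1 ht).le
        · have : η.normed volume t = 0 := by
            rw [← Function.notMem_support, η.support_normed_eq]
            exact ht
          simp [this]
    _ = _ := by rw [lintegral_mul_const _ (by fun_prop), hη1, one_mul]

/-- Supplies the constant dominating function for dominated convergence on balls. -/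
theorem exists_enorm_mollify_le (η : ContDiffBump (0 : EuclideanSpace ℝ (Fin d))) :
    ∃ M : NNReal, ∀ (u : H1 d) x, ‖mollify η (H1.fn u) x‖ₑ ^ 2 ≤ M * ‖u‖ₑ ^ 2 := by
  obtain ⟨C, hC⟩ := (η.hasCompactSupport_normed (μ := volume)).exists_bound_of_continuous
    η.continuous_normed
  have hη := (η.continuous_normed (μ := volume)).measurable
  have hfin : (∫⁻ t, ‖η.normed volume t‖ₑ) ≠ ∞ := η.integrable_normed.2.ne
  refine ⟨(∫⁻ t, ‖η.normed volume t‖ₑ).toNNReal * C.toNNReal, fun u x => ?_⟩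
  have hu := (stronglyMeasurable_fn u).measurable
  have h1 : ‖mollify η (H1.fn u) x‖ₑ ≤ ∫⁻ t, ‖η.normed volume (x - t)‖ₑ * ‖H1.fn u t‖ₑ := by
    refine (enorm_integral_le_lintegral_enorm _).trans (le_of_eq ?_)
    simp only [enorm_smul]
  refine (pow_le_pow_left' h1 2).trans ((lintegral_mul_sq_le (by fun_prop) (by fun_prop)).trans ?_)
  rw [lintegral_sub_left_eq_self (fun t => ‖η.normed volume t‖ₑ) x, ENNReal.coe_mul,
    ENNReal.coe_toNNReal hfin, mul_assoc]
  refine mul_le_mul_right ?_ _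
  calc ∫⁻ t, ‖η.normed volume (x - t)‖ₑ * ‖H1.fn u t‖ₑ ^ 2
      ≤ ∫⁻ t, (C.toNNReal : ℝ≥0∞) * ‖H1.fn u t‖ₑ ^ 2 := by
        gcongr with t
        rw [← ofReal_norm]
        exact ENNReal.ofReal_le_ofReal (hC _)
    _ = C.toNNReal * eLpNorm (H1.fn u) 2 volume ^ 2 := by
        rw [lintegral_const_mul _ (by fun_prop), eLpNorm_two_sq]
    _ ≤ _ := by
        gcongr
        exact eLpNorm_fn_le u

/-- For fixed `x`, the mollification at `x` is a bounded linear functional of `u`. -/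
theorem tendsto_mollify_of_weak (η : ContDiffBump (0 : EuclideanSpace ℝ (Fin d))) {u : ℕ → H1 d}
    (hw : ∀ f : H1 d →L[ℝ] ℝ, Tendsto (fun n => f (u n)) atTop (𝓝 0))
    (x : EuclideanSpace ℝ (Fin d)) :
    Tendsto (fun n => mollify η (H1.fn (u n)) x) atTop (𝓝 0) := by
  have hψ : MemLp (fun t => η.normed volume (x - t)) 2 volume :=
    memLp_test (η.continuous_normed.comp (by fun_prop))
      ((η.hasCompactSupport_normed (μ := volume)).comp_homeomorph (Homeomorph.subLeft x))
  obtain ⟨Λ, hΛ⟩ := exists_clm_eq_integral_smul (F := ℂ) hψ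
  have e : ∀ n, mollify η (H1.fn (u n)) x = Λ (valL d (u n)) := fun n => (hΛ _).symm
  have hre := hw (Complex.reCLM.comp (Λ.comp (valL d)))
  have him := hw (Complex.imCLM.comp (Λ.comp (valL d)))
  have h := (Complex.continuous_ofReal.tendsto _).comp hre |>.add
    (((Complex.continuous_ofReal.tendsto _).comp him).mul_const Complex.I)
  simp only [Complex.ofReal_zero, zero_mul, add_zero] at h
  refine h.congr fun n => ?_
  rw [e]
  exact Complex.re_add_im _

/-- The local Rellich theorem in `L²`. -/
theorem tendsto_eLpNorm_closedBall_of_weak {u : ℕ → H1 d} {R : ℝ} (hu : ∀ n, ‖u n‖ ≤ R)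
    (hw : ∀ f : H1 d →L[ℝ] ℝ, Tendsto (fun n => f (u n)) atTop (𝓝 0)) (ρ : ℝ) :
    Tendsto (fun n => eLpNorm (H1.fn (u n)) 2 (volume.restrict (Metric.closedBall 0 ρ))) atTop
      (𝓝 0) := by
  have hR : ∀ n, ‖u n‖ₑ ≤ ENNReal.ofReal R := fun n => by
    rw [← ofReal_norm]
    exact ENNReal.ofReal_le_ofReal (hu n)
  set B : Set (EuclideanSpace ℝ (Fin d)) := Metric.closedBall 0 ρ with hB
  have hBfin : volume B ≠ ∞ := measure_closedBall_lt_top.ne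
  have hmol : ∀ η : ContDiffBump (0 : EuclideanSpace ℝ (Fin d)),
      Tendsto (fun n => eLpNorm (mollify η (H1.fn (u n))) 2 (volume.restrict B)) atTop (𝓝 0) := by
    intro η
    obtain ⟨M, hM⟩ := exists_enorm_mollify_le η
    have hcont : ∀ n, Continuous (mollify η (H1.fn (u n))) := fun n =>
      (contDiff_mollify η (locallyIntegrable_lp _)).continuous
    have h : Tendsto (fun n => ∫⁻ x in B, ‖mollify η (H1.fn (u n)) x‖ₑ ^ 2) atTop
        (𝓝 (∫⁻ x in B, 0)) := by
      refine tendsto_lintegral_of_dominated_convergence (fun _ => M * ENNReal.ofReal R ^ 2) ?_ ?_ ?_ ?_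
      · intro n
        exact (hcont n).enorm.measurable.pow_const 2
      · intro n
        exact Eventually.of_forall fun x => (hM (u n) x).trans (mul_le_mul_right (pow_le_pow_left' (hR n) 2) _)
      · rw [setLIntegral_const]
        exact ENNReal.mul_ne_top (by finiteness) hBfin
      · refine Eventually.of_forall fun x => ?_
        have := (tendsto_mollify_of_weak η hw x).enorm
        simpa [Function.comp_def] using ((ENNReal.continuous_pow 2).tendsto _).comp this
    rw [lintegral_zero] at h
    have h2 := h.ennrpow_const (1 / 2)
    rw [ENNReal.zero_rpow_of_pos (by norm_num)] at h2
    refine h2.congr fun n => ?_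
    rw [← eLpNorm_two_sq, ← ENNReal.rpow_two, ← ENNReal.rpow_mul]
    norm_num
  rw [ENNReal.tendsto_nhds_zero]
  intro ε hε
  -- The radius is fixed before `n`: the mollification error is at most `r R` for every `n`, and
  -- only the mollified functions have to converge.
  obtain ⟨r, hr0, hr⟩ : ∃ r : ℝ, 0 < r ∧ ENNReal.ofReal r * ENNReal.ofReal R ≤ ε / 2 := by
    have h1 : Tendsto (fun r : ℝ => ENNReal.ofReal r * ENNReal.ofReal R) (𝓝[>] 0) (𝓝 0) := by
      have := (ENNReal.continuous_ofReal.tendsto 0).mono_left (nhdsWithin_le_nhds (s := Set.Ioi 0))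
      simpa using ENNReal.Tendsto.mul_const this (Or.inr (by finiteness : ENNReal.ofReal R ≠ ∞))
    have h2 := (ENNReal.tendsto_nhds_zero.1 h1 (ε / 2) (ENNReal.half_pos hε.ne'))
    obtain ⟨r, hr, hr'⟩ := (h2.and self_mem_nhdsWithin).exists
    exact ⟨r, hr', hr⟩
  let η : ContDiffBump (0 : EuclideanSpace ℝ (Fin d)) := ⟨r / 2, r, by positivity, by linarith⟩
  filter_upwards [ENNReal.tendsto_nhds_zero.1 (hmol η) (ε / 2) (ENNReal.half_pos hε.ne')] with n hn
  have hm1 : AEStronglyMeasurable (mollify η (H1.fn (u n))) (volume.restrict B) :=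
    (contDiff_mollify η (locallyIntegrable_lp _)).continuous.aestronglyMeasurable
  have hm2 : AEStronglyMeasurable (H1.fn (u n)) (volume.restrict B) :=
    (stronglyMeasurable_fn _).aestronglyMeasurable
  have e : H1.fn (u n) = mollify η (H1.fn (u n)) -
      (fun x => mollify η (H1.fn (u n)) x - H1.fn (u n) x) := by
    ext x
    simp
  calc eLpNorm (H1.fn (u n)) 2 (volume.restrict B)
      ≤ eLpNorm (mollify η (H1.fn (u n))) 2 (volume.restrict B) +
        eLpNorm (fun x => mollify η (H1.fn (u n)) x - H1.fn (u n) x) 2 (volume.restrict B) := by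
        conv_lhs => rw [e]
        exact eLpNorm_sub_le hm1 (hm1.sub hm2) (by norm_num)
    _ ≤ ε / 2 + ε / 2 := by
        gcongr
        refine (eLpNorm_mono_measure _ Measure.restrict_le_self).trans
          ((eLpNorm_mollify_sub_le η (u n)).trans (le_trans ?_ hr))
        gcongr
        exact (eLpNorm_grad_le _).trans (hR n)
    _ = ε := ENNReal.add_halves ε

/-! ### Weak continuity of the potential -/

/-- The decay of the weight supplies the compactness at infinity: the tail is small uniformly on
bounded sets, given the unweighted bound (`b = 0`). -/
theorem lpotential_compl_closedBall_le {b σ ρ : ℝ} (hb : 0 ≤ b) (hρ : 0 < ρ) (u : H1 d) :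
    lpotential b σ (Metric.closedBall 0 ρ)ᶜ u ≤
      ENNReal.ofReal (ρ ^ (-b)) * lpotential 0 σ Set.univ u := by
  have hu := (stronglyMeasurable_fn u).measurable
  calc lpotential b σ (Metric.closedBall 0 ρ)ᶜ u
      ≤ ∫⁻ x in (Metric.closedBall 0 ρ)ᶜ, ENNReal.ofReal (ρ ^ (-b)) * ‖H1.fn u x‖ₑ ^ (σ + 2) := by
        refine setLIntegral_mono (by fun_prop) fun x hx => ?_
        gcongr ENNReal.ofReal ?_ * _
        have hx' : ρ < ‖x‖ := by simpa using hx
        exact Real.rpow_le_rpow_of_nonpos hρ hx'.le (by linarith)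
    _ ≤ ∫⁻ x, ENNReal.ofReal (ρ ^ (-b)) * ‖H1.fn u x‖ₑ ^ (σ + 2) :=
        lintegral_mono' Measure.restrict_le_self le_rfl
    _ = _ := by
        rw [lintegral_const_mul _ (by fun_prop), lpotential, Measure.restrict_univ]
        simp

/-- The potential energy is continuous along weakly null sequences. -/
theorem tendsto_lpotential_of_weak (hd : 3 ≤ d) {b σ : ℝ} (hb : 0 < b) (hσ : 0 < σ)
    (hσ2 : σ < (4 - 2 * b) / ((d : ℝ) - 2)) {u : ℕ → H1 d} {R : ℝ} (hu : ∀ n, ‖u n‖ ≤ R)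
    (hw : ∀ f : H1 d →L[ℝ] ℝ, Tendsto (fun n => f (u n)) atTop (𝓝 0)) :
    Tendsto (fun n => lpotential b σ Set.univ (u n)) atTop (𝓝 0) := by
  have hd' : (3 : ℝ) ≤ d := by exact_mod_cast hd
  have hd2 : 0 < (d : ℝ) - 2 := by linarith
  have hR : ∀ n, ‖u n‖ₑ ≤ ENNReal.ofReal R := fun n => by
    rw [← ofReal_norm]
    exact ENNReal.ofReal_le_ofReal (hu n)
  -- The case `b = 0` allows a larger range of `σ`, so the unweighted integral is bounded too.
  have hσ0 : σ < (4 - 2 * 0) / ((d : ℝ) - 2) :=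
    hσ2.trans_le (div_le_div_of_nonneg_right (by linarith) hd2.le)
  obtain ⟨K, α, hα, hα2, hK⟩ := exists_lpotential_le hd hb.le hσ.le hσ2
  obtain ⟨K', hK'⟩ := exists_lpotential_univ_le hd le_rfl hσ.le hσ0
  have hC : (K' : ℝ≥0∞) * ENNReal.ofReal R ^ (σ + 2) ≠ ∞ :=
    ENNReal.mul_ne_top ENNReal.coe_ne_top
      (ENNReal.rpow_ne_top_of_nonneg (by linarith) ENNReal.ofReal_ne_top)
  rw [ENNReal.tendsto_nhds_zero]
  intro ε hε
  have hε2 := ENNReal.half_pos hε.ne'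
  obtain ⟨ρ, hρ, hρε⟩ : ∃ ρ : ℝ, 0 < ρ ∧
      ENNReal.ofReal (ρ ^ (-b)) * (K' * ENNReal.ofReal R ^ (σ + 2)) ≤ ε / 2 := by
    have h1 : Tendsto (fun ρ : ℝ => ENNReal.ofReal (ρ ^ (-b)) * (K' * ENNReal.ofReal R ^ (σ + 2)))
        atTop (𝓝 0) := by
      have := ENNReal.tendsto_ofReal (tendsto_rpow_neg_atTop hb)
      simpa using ENNReal.Tendsto.mul_const this (Or.inr hC)
    obtain ⟨ρ, h, h'⟩ := ((ENNReal.tendsto_nhds_zero.1 h1 _ hε2).and (eventually_gt_atTop 0)).exists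
    exact ⟨ρ, h', h⟩
  have hball : Tendsto (fun n => (K : ℝ≥0∞) * ENNReal.ofReal R ^ (σ + 2 - 2 * α) *
      (eLpNorm (H1.fn (u n)) 2 (volume.restrict (Metric.closedBall 0 ρ)) ^ 2) ^ α) atTop (𝓝 0) := by
    have h1 := ((ENNReal.continuous_pow 2).tendsto _).comp (tendsto_eLpNorm_closedBall_of_weak hu hw ρ)
    have h2 := h1.ennrpow_const α
    have h3 : (K : ℝ≥0∞) * ENNReal.ofReal R ^ (σ + 2 - 2 * α) ≠ ∞ :=
      ENNReal.mul_ne_top ENNReal.coe_ne_top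
        (ENNReal.rpow_ne_top_of_nonneg (by linarith) ENNReal.ofReal_ne_top)
    have h4 := ENNReal.Tendsto.const_mul h2 (Or.inr h3)
    simpa [ENNReal.zero_rpow_of_pos hα, Function.comp_def] using h4
  filter_upwards [ENNReal.tendsto_nhds_zero.1 hball _ hε2] with n hn
  calc lpotential b σ Set.univ (u n)
      = lpotential b σ (Metric.closedBall 0 ρ) (u n) +
        lpotential b σ (Metric.closedBall 0 ρ)ᶜ (u n) := by
        simp only [lpotential, Measure.restrict_univ]
        exact (lintegral_add_compl _ measurableSet_closedBall).symm
    _ ≤ ε / 2 + ε / 2 := by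
        gcongr
        · refine (hK _ _).trans (le_trans ?_ hn)
          rw [eLpNorm_two_sq]
          gcongr
          exact hR n
        · refine (lpotential_compl_closedBall_le hb.le hρ _).trans (le_trans ?_ hρε)
          gcongr
          refine (hK' _).trans ?_
          gcongr
          exact hR n
    _ = ε := ENNReal.add_halves ε

/-! ### Real-valued potential: homogeneity, convexity, positivity -/

theorem ofReal_potential_integrand {b σ : ℝ} (hσ : 0 < σ) (u : H1 d)
    (x : EuclideanSpace ℝ (Fin d)) :
    ENNReal.ofReal (‖x‖ ^ (-b) * ‖H1.fn u x‖ ^ (σ + 2)) =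
      ENNReal.ofReal (‖x‖ ^ (-b)) * ‖H1.fn u x‖ₑ ^ (σ + 2) := by
  rw [ENNReal.ofReal_mul (by positivity), ← ofReal_norm,
    ENNReal.ofReal_rpow_of_nonneg (norm_nonneg _) (by linarith)]

theorem measurable_potential_integrand (b σ : ℝ) (u : H1 d) :
    Measurable fun x : EuclideanSpace ℝ (Fin d) => ‖x‖ ^ (-b) * ‖H1.fn u x‖ ^ (σ + 2) := by
  have hu := (stronglyMeasurable_fn u).measurable
  fun_prop

theorem potential_eq_toReal {b σ : ℝ} (hσ : 0 < σ) (u : H1 d) :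
    potential b σ u = (lpotential b σ Set.univ u).toReal := by
  rw [potential, integral_eq_lintegral_of_nonneg_ae (Eventually.of_forall fun x => by positivity)
    (measurable_potential_integrand b σ u).aestronglyMeasurable, lpotential, Measure.restrict_univ]
  simp only [ofReal_potential_integrand hσ]

theorem lpotential_ne_top (hd : 3 ≤ d) {b σ : ℝ} (hb : 0 < b) (hσ : 0 < σ)
    (hσ2 : σ < (4 - 2 * b) / ((d : ℝ) - 2)) (u : H1 d) : lpotential b σ Set.univ u ≠ ∞ := by
  obtain ⟨K, hK⟩ := exists_lpotential_univ_le hd hb.le hσ.le hσ2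
  refine ((hK u).trans_lt (ENNReal.mul_lt_top ENNReal.coe_lt_top ?_)).ne
  exact ENNReal.rpow_lt_top_of_nonneg (by linarith) enorm_ne_top

theorem integrable_potential (hd : 3 ≤ d) {b σ : ℝ} (hb : 0 < b) (hσ : 0 < σ)
    (hσ2 : σ < (4 - 2 * b) / ((d : ℝ) - 2)) (u : H1 d) :
    Integrable (fun x : EuclideanSpace ℝ (Fin d) => ‖x‖ ^ (-b) * ‖H1.fn u x‖ ^ (σ + 2)) volume := by
  refine ⟨(measurable_potential_integrand b σ u).aestronglyMeasurable, ?_⟩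
  rw [hasFiniteIntegral_iff_ofReal (Eventually.of_forall fun x => by positivity)]
  simp only [ofReal_potential_integrand hσ]
  have := lpotential_ne_top hd hb hσ hσ2 u
  rw [lpotential, Measure.restrict_univ] at this
  exact this.lt_top

theorem exists_potential_le (hd : 3 ≤ d) {b σ : ℝ} (hb : 0 < b) (hσ : 0 < σ)
    (hσ2 : σ < (4 - 2 * b) / ((d : ℝ) - 2)) :
    ∃ K : ℝ, 0 ≤ K ∧ ∀ u : H1 d, potential b σ u ≤ K * ‖u‖ ^ (σ + 2) := by
  obtain ⟨K, hK⟩ := exists_lpotential_univ_le hd hb.le hσ.le hσ2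
  refine ⟨K, K.2, fun u => ?_⟩
  have hfin : (K : ℝ≥0∞) * ‖u‖ₑ ^ (σ + 2) ≠ ∞ := ENNReal.mul_ne_top ENNReal.coe_ne_top
    (ENNReal.rpow_ne_top_of_nonneg (by linarith) enorm_ne_top)
  have h := ENNReal.toReal_mono hfin (hK u)
  rw [potential_eq_toReal hσ]
  refine h.trans (le_of_eq ?_)
  simp [ENNReal.toReal_mul, ← ENNReal.toReal_rpow]

theorem potential_nonneg (b σ : ℝ) (u : H1 d) : 0 ≤ potential b σ u :=
  integral_nonneg fun x => by positivity

theorem potential_smul {b σ : ℝ} (t : ℝ) (u : H1 d) :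
    potential b σ (t • u) = |t| ^ (σ + 2) * potential b σ u := by
  rw [potential, potential, ← integral_const_mul]
  refine integral_congr_ae ?_
  filter_upwards [fn_smul t u] with x hx
  rw [hx, norm_smul, Real.mul_rpow (norm_nonneg _) (norm_nonneg _), Real.norm_eq_abs]
  ring

theorem two_mul_norm_rpow_le {p : ℝ} (hp : 1 ≤ p) (z w : ℂ) :
    2 * ‖z‖ ^ p ≤ ‖z + w‖ ^ p + ‖z - w‖ ^ p := by
  have h1 : ‖z‖ ≤ (1 / 2 : ℝ) * ‖z + w‖ + (1 / 2 : ℝ) * ‖z - w‖ := by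
    have h : ‖(2 : ℂ) * z‖ ≤ ‖z + w‖ + ‖z - w‖ := by
      have := norm_add_le (z + w) (z - w)
      rwa [show z + w + (z - w) = 2 * z by ring] at this
    rw [norm_mul, Complex.norm_ofNat] at h
    linarith
  have h2 := (convexOn_rpow hp).2 (Set.mem_Ici.2 (norm_nonneg (z + w)))
    (Set.mem_Ici.2 (norm_nonneg (z - w))) (by norm_num : (0 : ℝ) ≤ 1 / 2)
    (by norm_num : (0 : ℝ) ≤ 1 / 2) (by norm_num)
  simp only [smul_eq_mul] at h2
  have h3 := Real.rpow_le_rpow (norm_nonneg _) h1 (by linarith : 0 ≤ p)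
  linarith

/-- Midpoint convexity, integrated from the pointwise inequality; it is the lower bound used by
`hasFDerivAt_of_touching`. -/
theorem two_mul_potential_le (hd : 3 ≤ d) {b σ : ℝ} (hb : 0 < b) (hσ : 0 < σ)
    (hσ2 : σ < (4 - 2 * b) / ((d : ℝ) - 2)) (u v : H1 d) :
    2 * potential b σ u ≤ potential b σ (u + v) + potential b σ (u - v) := by
  have hi := integrable_potential hd hb hσ hσ2
  rw [potential, potential, potential, ← integral_const_mul, ← integral_add (hi _) (hi _)]
  refine integral_mono_ae ((hi u).const_mul 2) ((hi _).add (hi _)) ?_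
  filter_upwards [fn_add u v, fn_sub u v] with x h1 h2
  simp only [h1, h2]
  have := mul_le_mul_of_nonneg_left (two_mul_norm_rpow_le (by linarith : 1 ≤ σ + 2)
    (H1.fn u x) (H1.fn v x)) (by positivity : 0 ≤ ‖x‖ ^ (-b))
  linarith

/-- Minkowski's inequality in `L^(σ+2)`, after the `1/(σ+2)` power of the weight is moved into the
function. -/
theorem lpotential_rpow_add_le {b σ : ℝ} (hσ : 0 < σ) (u v : H1 d) :
    lpotential b σ Set.univ (u + v) ^ (1 / (σ + 2)) ≤
      lpotential b σ Set.univ u ^ (1 / (σ + 2)) + lpotential b σ Set.univ v ^ (1 / (σ + 2)) := by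
  have hp : 0 < σ + 2 := by linarith
  let W : H1 d → EuclideanSpace ℝ (Fin d) → ℝ≥0∞ := fun u x =>
    ENNReal.ofReal (‖x‖ ^ (-b)) ^ (1 / (σ + 2)) * ‖H1.fn u x‖ₑ
  have hW : ∀ u x, W u x ^ (σ + 2) = ENNReal.ofReal (‖x‖ ^ (-b)) * ‖H1.fn u x‖ₑ ^ (σ + 2) := by
    intro u x
    rw [ENNReal.mul_rpow_of_nonneg _ _ hp.le, ← ENNReal.rpow_mul, one_div,
      inv_mul_cancel₀ hp.ne', ENNReal.rpow_one]
  have hm : ∀ u, AEMeasurable (W u) volume := fun u => by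
    have hu := (stronglyMeasurable_fn u).measurable
    fun_prop
  simp only [lpotential, Measure.restrict_univ, ← hW]
  refine le_trans ?_ (ENNReal.lintegral_Lp_add_le (hm u) (hm v) (by linarith : 1 ≤ σ + 2))
  refine ENNReal.rpow_le_rpow (lintegral_mono_ae ?_) (by positivity)
  filter_upwards [fn_add u v] with x hx
  refine ENNReal.rpow_le_rpow ?_ hp.le
  simp only [W, hx, Pi.add_apply, ← mul_add]
  gcongr
  exact enorm_add_le _ _

theorem ae_eq_zero_of_potential_eq_zero (hd : 3 ≤ d) {b σ : ℝ} (hb : 0 < b) (hσ : 0 < σ)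
    (hσ2 : σ < (4 - 2 * b) / ((d : ℝ) - 2)) {u : H1 d} (h : potential b σ u = 0) :
    H1.fn u =ᵐ[volume] 0 := by
  have hNZ : Nonempty (Fin d) := ⟨⟨0, by omega⟩⟩
  have h1 := (integral_eq_zero_iff_of_nonneg (fun x => by positivity)
    (integrable_potential hd hb hσ hσ2 u)).1 h
  have h0 : ∀ᵐ x : EuclideanSpace ℝ (Fin d), x ≠ 0 := by
    simp [ae_iff]
  filter_upwards [h1, h0] with x hx hx0
  have hne : ‖x‖ ^ (-b) ≠ 0 := (Real.rpow_pos_of_pos (norm_pos_iff.2 hx0) _).ne'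
  have h2 := (mul_eq_zero.1 hx).resolve_left hne
  exact norm_eq_zero.1 ((Real.rpow_eq_zero (norm_nonneg _) (by linarith)).1 h2)

/-- Real test functions are elements of `H¹`. -/
theorem exists_H1_of_testFunction {φ : EuclideanSpace ℝ (Fin d) → ℝ}
    (hφ : ContDiff ℝ (⊤ : ℕ∞) φ) (hc : HasCompactSupport φ) :
    ∃ u : H1 d, H1.fn u =ᵐ[volume] fun x => (φ x : ℂ) := by
  have hd : Continuous (fderiv ℝ φ) := hφ.continuous_fderiv (by simp)
  have hm : MemLp (fun x => (φ x : ℂ)) 2 volume :=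
    (Complex.continuous_ofReal.comp hφ.continuous).memLp_of_hasCompactSupport
      (hc.comp_left (g := Complex.ofReal) Complex.ofReal_zero)
  let G : EuclideanSpace ℝ (Fin d) → EuclideanSpace ℂ (Fin d) := fun x =>
    WithLp.toLp 2 fun i => (fderiv ℝ φ x (EuclideanSpace.single i 1) : ℂ)
  have hGc : Continuous G := by
    refine (PiLp.continuous_toLp 2 _).comp (continuous_pi fun i => ?_)
    exact Complex.continuous_ofReal.comp (hd.clm_apply continuous_const)
  have hGs : HasCompactSupport G := by
    refine (hc.fderiv ℝ).mono fun x hx => ?_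
    contrapose! hx
    have h0 : fderiv ℝ φ x = 0 := by simpa using hx
    have h1 : G x = 0 := by
      ext i
      simp [G, h0]
    simpa using h1
  have hG : MemLp G 2 volume := hGc.memLp_of_hasCompactSupport hGs
  refine ⟨⟨WithLp.toLp 2 (hm.toLp, hG.toLp), ?_⟩, hm.coeFn_toLp⟩
  intro ψ hψ hψc i
  have hψd : Continuous (fderiv ℝ ψ) := hψ.continuous_fderiv (by simp)
  have e1 : ∫ x, fderiv ℝ ψ x (EuclideanSpace.single i 1) • (hm.toLp : L2 d ℂ) x =
      ((∫ x, fderiv ℝ ψ x (EuclideanSpace.single i 1) * φ x : ℝ) : ℂ) := by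
    rw [← integral_complex_ofReal]
    refine integral_congr_ae ?_
    filter_upwards [hm.coeFn_toLp] with x hx
    rw [hx]
    simp
  have e2 : ∫ x, ψ x • (hG.toLp : L2 d (EuclideanSpace ℂ (Fin d))) x i =
      ((∫ x, ψ x * fderiv ℝ φ x (EuclideanSpace.single i 1) : ℝ) : ℂ) := by
    rw [← integral_complex_ofReal]
    refine integral_congr_ae ?_
    filter_upwards [hG.coeFn_toLp] with x hx
    rw [hx]
    simp [G]
  refine e1.trans (Eq.trans ?_ (congrArg Neg.neg e2.symm))
  rw [← Complex.ofReal_neg, Complex.ofReal_inj]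
  have := integral_mul_fderiv_eq_neg_fderiv_mul_of_integrable (𝕜 := ℝ) (f := ψ) (g := φ)
    (μ := volume) (v := EuclideanSpace.single i (1 : ℝ))
    (((hψd.clm_apply continuous_const).mul hφ.continuous).integrable_of_hasCompactSupport
      hc.mul_left)
    ((hψ.continuous.mul (hd.clm_apply continuous_const)).integrable_of_hasCompactSupport
      hψc.mul_right)
    ((hψ.continuous.mul hφ.continuous).integrable_of_hasCompactSupport hc.mul_left)
    (fun x _ => hψ.differentiable (by simp) x) (fun x _ => hφ.differentiable (by simp) x)
  rw [this, neg_neg]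

theorem exists_potential_pos (hd : 3 ≤ d) {b σ : ℝ} (hb : 0 < b) (hσ : 0 < σ)
    (hσ2 : σ < (4 - 2 * b) / ((d : ℝ) - 2)) : ∃ u : H1 d, 0 < potential b σ u := by
  let χ : ContDiffBump (0 : EuclideanSpace ℝ (Fin d)) := ⟨1, 2, by norm_num, by norm_num⟩
  obtain ⟨u, hu⟩ := exists_H1_of_testFunction χ.contDiff χ.hasCompactSupport
  refine ⟨u, (potential_nonneg b σ u).lt_of_ne' fun h => ?_⟩
  have h0 := hu.symm.trans (ae_eq_zero_of_potential_eq_zero hd hb hσ hσ2 h)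
  have h1 : volume (Metric.ball (0 : EuclideanSpace ℝ (Fin d)) 1) = 0 := by
    refine measure_mono_null (fun x hx => ?_) (ae_iff.1 h0)
    have : χ x = 1 := χ.one_of_mem_closedBall (Metric.ball_subset_closedBall hx)
    simp [this]
  exact (Metric.measure_ball_pos volume _ one_pos).ne' h1

/-! ### The sharp constant is attained -/

/-- Since `Q ≥ 0`, the expansion at `v` gives `Q(uₙ) ≥ Q(v) + Q'(v)(uₙ - v)`, and the linear term
tends to zero. -/
theorem quad_le_of_weak (hd : 3 ≤ d) {c ω : ℝ} (hω : 0 < ω)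
    (hcd : c < (((d : ℝ) - 2) / 2) ^ 2) {u : ℕ → H1 d} {v : H1 d} {q : ℝ}
    (hw : ∀ f : H1 d →L[ℝ] ℝ, Tendsto (fun n => f (u n)) atTop (𝓝 (f v)))
    (hq : ∀ n, quad c ω (u n) ≤ q) : quad c ω v ≤ q := by
  obtain ⟨κ, hκ, hκQ⟩ := exists_le_quad hd hω hcd
  have h := ((hw (quadDeriv hd c ω v)).sub_const (quadDeriv hd c ω v v)).const_add (quad c ω v)
  simp only [sub_self, add_zero] at h
  refine le_of_tendsto h (Eventually.of_forall fun n => ?_)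
  have h1 := quad_add hd c ω v (u n - v)
  rw [add_sub_cancel, map_sub] at h1
  have h2 : 0 ≤ quad c ω (u n - v) := le_trans (by positivity) (hκQ _)
  linarith [hq n]

/-- The direct method. The constraint is `Q ≤ 1` and not `Q = 1` because only the inequality
survives weak limits. -/
theorem exists_isMaxOn_potential (hd : 3 ≤ d) {b σ c ω : ℝ} (hb : 0 < b) (hσ : 0 < σ)
    (hσ2 : σ < (4 - 2 * b) / ((d : ℝ) - 2)) (hω : 0 < ω)
    (hcd : c < (((d : ℝ) - 2) / 2) ^ 2) :
    ∃ v : H1 d, quad c ω v ≤ 1 ∧ ∀ w : H1 d, quad c ω w ≤ 1 → potential b σ w ≤ potential b σ v := by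
  obtain ⟨κ, hκ, hκQ⟩ := exists_le_quad hd hω hcd
  obtain ⟨K, hK0, hK⟩ := exists_potential_le hd hb hσ hσ2
  have hp : 0 < σ + 2 := by linarith
  have hnorm : ∀ w : H1 d, quad c ω w ≤ 1 → ‖w‖ ≤ Real.sqrt κ⁻¹ := by
    intro w hw
    refine Real.le_sqrt_of_sq_le ?_
    rw [← one_div, le_div_iff₀ hκ]
    linarith [hκQ w]
  set S : Set ℝ := potential b σ '' {w : H1 d | quad c ω w ≤ 1} with hS
  have hSne : S.Nonempty := ⟨_, 0, by simp [quad_eq hd], rfl⟩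
  have hSb : BddAbove S := by
    refine ⟨K * Real.sqrt κ⁻¹ ^ (σ + 2), ?_⟩
    rintro _ ⟨w, hw, rfl⟩
    refine (hK w).trans ?_
    gcongr
    exact hnorm w hw
  obtain ⟨a, -, ha, haS⟩ := exists_seq_tendsto_sSup hSne hSb
  choose u hu hua using haS
  obtain ⟨v, φ, hφ, hv⟩ := exists_subseq_tendsto_weak_real (fun n => hnorm (u n) (hu n))
  have hvQ : quad c ω v ≤ 1 := quad_le_of_weak hd hω hcd hv fun n => hu (φ n)
  refine ⟨v, hvQ, fun w hw => (le_csSup hSb ⟨w, hw, rfl⟩).trans ?_⟩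
  have hlim : Tendsto (fun n => lpotential b σ Set.univ (u (φ n) - v)) atTop (𝓝 0) := by
    refine tendsto_lpotential_of_weak hd hb hσ hσ2 (R := Real.sqrt κ⁻¹ + ‖v‖) ?_ ?_
    · intro n
      refine (norm_sub_le _ _).trans ?_
      gcongr
      exact hnorm _ (hu _)
    · intro f
      simpa using (hv f).sub_const (f v)
  -- By Minkowski, `P(uₙ)^(1/(σ+2))` is at most the same quantity for `v` plus a term tending to
  -- zero, so `sup P ≤ P(v)`.
  have h1 : Tendsto (fun n => lpotential b σ Set.univ v ^ (1 / (σ + 2)) +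
      lpotential b σ Set.univ (u (φ n) - v) ^ (1 / (σ + 2))) atTop
      (𝓝 (lpotential b σ Set.univ v ^ (1 / (σ + 2)))) := by
    have := (tendsto_const_nhds (x := lpotential b σ Set.univ v ^ (1 / (σ + 2)))).add
      (hlim.ennrpow_const (1 / (σ + 2)))
    rwa [ENNReal.zero_rpow_of_pos (by positivity), add_zero] at this
  have h2 := h1.ennrpow_const (σ + 2)
  rw [← ENNReal.rpow_mul, one_div, inv_mul_cancel₀ hp.ne', ENNReal.rpow_one] at h2
  have h3 := ENNReal.tendsto_ofReal (ha.comp hφ.tendsto_atTop)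
  have h4 : ENNReal.ofReal (sSup S) ≤ lpotential b σ Set.univ v := by
    refine le_of_tendsto_of_tendsto' h3 h2 fun n => ?_
    have h5 := lpotential_rpow_add_le (b := b) hσ v (u (φ n) - v)
    rw [add_sub_cancel] at h5
    have h6 := ENNReal.rpow_le_rpow h5 hp.le
    rw [← ENNReal.rpow_mul, one_div, inv_mul_cancel₀ hp.ne', ENNReal.rpow_one] at h6
    refine le_trans (le_of_eq ?_) h6
    rw [Function.comp_apply, ← hua, potential_eq_toReal hσ,
      ENNReal.ofReal_toReal (lpotential_ne_top hd hb hσ hσ2 _)]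
  rw [potential_eq_toReal hσ]
  exact (ENNReal.ofReal_le_iff_le_toReal (lpotential_ne_top hd hb hσ hσ2 v)).1 h4

/-- The sharp weighted Gagliardo–Nirenberg-type inequality `P ≤ M Q^{(σ+2)/2}` is attained. -/
theorem exists_sharp_constant (hd : 3 ≤ d) {b σ c ω : ℝ} (hb : 0 < b) (hσ : 0 < σ)
    (hσ2 : σ < (4 - 2 * b) / ((d : ℝ) - 2)) (hω : 0 < ω)
    (hcd : c < (((d : ℝ) - 2) / 2) ^ 2) :
    ∃ M : ℝ, 0 < M ∧
      (∀ w : H1 d, potential b σ w ≤ M * quad c ω w ^ ((σ + 2) / 2)) ∧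
      ∃ v : H1 d, 0 < quad c ω v ∧ potential b σ v = M * quad c ω v ^ ((σ + 2) / 2) := by
  obtain ⟨κ, hκ, hκQ⟩ := exists_le_quad hd hω hcd
  obtain ⟨v, hv1, hv⟩ := exists_isMaxOn_potential hd hb hσ hσ2 hω hcd
  have hp : 0 < σ + 2 := by linarith
  have hP0 : potential b σ (0 : H1 d) = 0 := by
    have := potential_smul (b := b) (σ := σ) 0 (0 : H1 d)
    rwa [smul_zero, abs_zero, Real.zero_rpow hp.ne', zero_mul] at this
  have hQpos : ∀ w : H1 d, w ≠ 0 → 0 < quad c ω w := fun w hw =>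
    (by have := norm_pos_iff.2 hw; positivity : 0 < κ * ‖w‖ ^ 2).trans_le (hκQ w)
  have hbound : ∀ w : H1 d, potential b σ w ≤ potential b σ v * quad c ω w ^ ((σ + 2) / 2) := by
    intro w
    by_cases hw : w = 0
    · rw [hw, hP0]
      refine mul_nonneg (potential_nonneg b σ v) (Real.rpow_nonneg ?_ _)
      simp [quad_eq hd]
    have hq := hQpos w hw
    have hs : 0 < Real.sqrt (quad c ω w) := Real.sqrt_pos.2 hq
    -- Rescaling `w` to `Q = 1` turns the maximum into a homogeneous inequality.
    have h1 := hv ((Real.sqrt (quad c ω w))⁻¹ • w) (by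
      rw [quad_smul hd, inv_pow, Real.sq_sqrt hq.le, inv_mul_cancel₀ hq.ne'])
    rw [potential_smul, abs_of_pos (inv_pos.2 hs), Real.inv_rpow hs.le, Real.sqrt_eq_rpow,
      ← Real.rpow_mul hq.le, inv_mul_le_iff₀ (Real.rpow_pos_of_pos hq _)] at h1
    rw [mul_comm, show (σ + 2) / 2 = 1 / 2 * (σ + 2) by ring]
    exact h1
  have hMpos : 0 < potential b σ v := by
    obtain ⟨w, hw⟩ := exists_potential_pos hd hb hσ hσ2
    by_contra h
    have h0 : potential b σ v = 0 := le_antisymm (not_lt.1 h) (potential_nonneg b σ v)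
    have := hbound w
    rw [h0, zero_mul] at this
    linarith
  have hv0 : v ≠ 0 := by
    rintro rfl
    exact hMpos.ne' hP0
  refine ⟨potential b σ v, hMpos, hbound, v, hQpos v hv0, le_antisymm (hbound v) ?_⟩
  -- Here `M = P(v)`, so `Q(v) ≤ 1` gives the reverse inequality.
  exact mul_le_of_le_one_right hMpos.le (Real.rpow_le_one (hQpos v hv0).le hv1 (by positivity))

/-! ### Criticality and the Nehari condition -/

/-- A midpoint-convex function that is touched from above by a differentiable function is
differentiable at the point of contact. -/
theorem hasFDerivAt_of_touching {E : Type*} [NormedAddCommGroup E] [NormedSpace ℝ E]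
    {f g : E → ℝ} {L : E →L[ℝ] ℝ} {x : E} (hf : ∀ v, 2 * f x ≤ f (x + v) + f (x - v))
    (hfg : ∀ y, f y ≤ g y) (hx : f x = g x) (hg : HasFDerivAt g L x) : HasFDerivAt f L x := by
  rw [hasFDerivAt_iff_isLittleO_nhds_zero] at hg ⊢
  -- The lower bound comes from the reflected point: `f(x+h) - f(x) ≥ f(x) - f(x-h) ≥ g(x) -
  -- g(x-h)`.
  have hneg : (fun h : E => g (x + -h) - g x - L (-h)) =o[𝓝 0] fun h => h := by
    have ht : Tendsto (fun h : E => -h) (𝓝 0) (𝓝 0) := by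
      simpa using (continuous_neg (G := E)).tendsto 0
    simpa [Function.comp_def] using (hg.comp_tendsto ht).neg_right
  have hsum := hg.norm_left.add hneg.norm_left
  refine (Asymptotics.IsBigO.of_bound 1 (Eventually.of_forall fun h => ?_)).trans_isLittleO hsum
  simp only [Real.norm_eq_abs, one_mul]
  rw [abs_of_nonneg (by positivity :
    0 ≤ |g (x + h) - g x - L h| + |g (x + -h) - g x - L (-h)|)]
  have h1 := hf h
  have h2 := hfg (x + h)
  have h3 := hfg (x - h)
  rw [sub_eq_add_neg x h] at h1 h3
  rw [map_neg]
  have h4 := neg_abs_le (g (x + h) - g x - L h)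
  have h5 := le_abs_self (g (x + h) - g x - L h)
  have h6 := le_abs_self (g (x + -h) - g x - -L h)
  have h7 := abs_nonneg (g (x + -h) - g x - -L h)
  have h8 := abs_nonneg (g (x + h) - g x - L h)
  rw [abs_le]
  constructor <;> linarith

theorem action_eq (b σ c ω : ℝ) (u : H1 d) :
    action b σ c ω u = 1 / 2 * quad c ω u - 1 / (σ + 2) * potential b σ u := by
  rw [action, energy, quad]
  ring

theorem nehari_eq (b σ c ω : ℝ) (u : H1 d) :
    nehari b σ c ω u = quad c ω u - potential b σ u := rfl

theorem hasDerivAt_action_smul (hd : 3 ≤ d) {b σ c ω : ℝ} (hσ : 0 < σ) (u : H1 d) :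
    HasDerivAt (fun t : ℝ => action b σ c ω (t • u)) (nehari b σ c ω u) 1 := by
  have hp : σ + 2 ≠ 0 := by linarith
  have h1 := ((hasDerivAt_pow 2 (1 : ℝ)).mul_const (quad c ω u)).const_mul (1 / 2)
  have h2 := ((Real.hasDerivAt_rpow_const (x := 1) (p := σ + 2) (Or.inl one_ne_zero)).mul_const
    (potential b σ u)).const_mul (1 / (σ + 2))
  have h3 := h1.sub h2
  have e : nehari b σ c ω u = 1 / 2 * ((2 : ℕ) * (1 : ℝ) ^ (2 - 1) * quad c ω u) -
      1 / (σ + 2) * ((σ + 2) * (1 : ℝ) ^ (σ + 2 - 1) * potential b σ u) := by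
    rw [nehari_eq, Real.one_rpow]
    field_simp
    norm_num
    ring
  rw [e]
  refine h3.congr_of_eventuallyEq ?_
  filter_upwards [eventually_gt_nhds (zero_lt_one (α := ℝ))] with t ht
  simp only [action_eq, quad_smul hd, potential_smul, abs_of_pos ht, Pi.sub_apply]

theorem nehari_eq_zero_of_critical (hd : 3 ≤ d) {b σ c ω : ℝ} (hσ : 0 < σ) {u : H1 d}
    (hu : HasFDerivAt (action b σ c ω) (0 : H1 d →L[ℝ] ℝ) u) : nehari b σ c ω u = 0 := by
  have h1 : HasDerivAt (fun t : ℝ => t • u) u 1 := by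
    simpa using (hasDerivAt_id (1 : ℝ)).smul_const u
  have h2 : HasDerivAt (fun t : ℝ => action b σ c ω (t • u)) ((0 : H1 d →L[ℝ] ℝ) u) 1 := by
    have hu' : HasFDerivAt (action b σ c ω) (0 : H1 d →L[ℝ] ℝ) ((1 : ℝ) • u) := by
      rwa [one_smul]
    exact hu'.comp_hasDerivAt (1 : ℝ) h1
  exact (hasDerivAt_action_smul hd hσ u).unique h2

/-- At an optimizer `P` touches `M Q^((σ+2)/2)` from below, so `P'` is the derivative of that power,
a multiple of `Q'`. The Nehari condition fixes the multiple so that `S' = 0`. -/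
theorem hasFDerivAt_action_zero (hd : 3 ≤ d) {b σ c ω M : ℝ} (hb : 0 < b) (hσ : 0 < σ)
    (hσ2 : σ < (4 - 2 * b) / ((d : ℝ) - 2))
    (hM : ∀ w : H1 d, potential b σ w ≤ M * quad c ω w ^ ((σ + 2) / 2)) {u : H1 d}
    (hQ : 0 < quad c ω u) (hK : nehari b σ c ω u = 0)
    (hu : potential b σ u = M * quad c ω u ^ ((σ + 2) / 2)) :
    HasFDerivAt (action b σ c ω) (0 : H1 d →L[ℝ] ℝ) u := by
  have hp : σ + 2 ≠ 0 := by linarith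
  have hR := ((hasFDerivAt_quad hd c ω u).rpow_const (p := (σ + 2) / 2) (Or.inl hQ.ne')).const_mul M
  have hP := hasFDerivAt_of_touching (two_mul_potential_le hd hb hσ hσ2 u) hM hu hR
  -- `K = 0` and optimality give `Q = P = M Q^((σ+2)/2)`; divide by `Q`.
  have hcoef : M * quad c ω u ^ ((σ + 2) / 2 - 1) = 1 := by
    rw [nehari_eq, hu, sub_eq_zero] at hK
    rw [Real.rpow_sub_one hQ.ne', ← mul_div_assoc, ← hK, div_self hQ.ne']
  have hS := ((hasFDerivAt_quad hd c ω u).const_mul (1 / 2)).sub (hP.const_mul (1 / (σ + 2)))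
  have e : action (d := d) b σ c ω =
      fun u => 1 / 2 * quad c ω u - 1 / (σ + 2) * potential b σ u := funext (action_eq b σ c ω)
  rw [e]
  refine hS.congr_fderiv ?_
  have h2 : (1 / (σ + 2)) * (M * ((σ + 2) / 2 * quad c ω u ^ ((σ + 2) / 2 - 1))) = 1 / 2 := by
    calc _ = (M * quad c ω u ^ ((σ + 2) / 2 - 1)) * ((σ + 2) / (σ + 2)) / 2 := by ring
      _ = 1 / 2 := by rw [hcoef, div_self hp, one_mul]
  simp only [smul_smul]
  rw [h2, sub_self]

/-! ### The Nehari level and the ground states -/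

/-- The value of the quadratic part on the minimizers of the Nehari problem. -/
theorem exists_nehari_level (hd : 3 ≤ d) {b σ c ω : ℝ} (hb : 0 < b) (hσ : 0 < σ)
    (hσ2 : σ < (4 - 2 * b) / ((d : ℝ) - 2)) (hω : 0 < ω)
    (hcd : c < (((d : ℝ) - 2) / 2) ^ 2) :
    ∃ m : ℝ, 0 < m ∧
      (∀ u : H1 d, u ≠ 0 → nehari b σ c ω u = 0 → m ≤ quad c ω u) ∧
      (∃ u : H1 d, quad c ω u = m ∧ nehari b σ c ω u = 0) ∧
      ∀ u : H1 d, quad c ω u = m → nehari b σ c ω u = 0 →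
        HasFDerivAt (action b σ c ω) (0 : H1 d →L[ℝ] ℝ) u := by
  obtain ⟨κ, hκ, hκQ⟩ := exists_le_quad hd hω hcd
  obtain ⟨M, hM0, hM, v, hv0, hv⟩ := exists_sharp_constant hd hb hσ hσ2 hω hcd
  have hp : 0 < σ + 2 := by linarith
  have hexp : (σ + 2) / 2 = σ / 2 + 1 := by ring
  -- The positive solution of `M m^((σ+2)/2) = m`.
  set m : ℝ := M⁻¹ ^ (2 / σ) with hm
  have hm0 : 0 < m := Real.rpow_pos_of_pos (inv_pos.2 hM0) _
  have hmM : M * m ^ (σ / 2) = 1 := by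
    rw [hm, ← Real.rpow_mul (inv_pos.2 hM0).le, show 2 / σ * (σ / 2) = 1 by field_simp,
      Real.rpow_one, mul_inv_cancel₀ hM0.ne']
  have hmm : M * m ^ ((σ + 2) / 2) = m := by
    rw [hexp, Real.rpow_add_one hm0.ne', ← mul_assoc, hmM, one_mul]
  refine ⟨m, hm0, ?_, ?_, ?_⟩
  · intro u hu hK
    have hq : 0 < quad c ω u :=
      (by have := norm_pos_iff.2 hu; positivity : 0 < κ * ‖u‖ ^ 2).trans_le (hκQ u)
    have h1 := hM u
    rw [nehari_eq, sub_eq_zero] at hK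
    rw [← hK, hexp, Real.rpow_add_one hq.ne', ← mul_assoc] at h1
    have h2 : 1 ≤ M * quad c ω u ^ (σ / 2) := le_of_mul_le_mul_right (by rwa [one_mul]) hq
    rw [← hmM] at h2
    exact (Real.rpow_le_rpow_iff hm0.le hq.le (by positivity)).1 (le_of_mul_le_mul_left h2 hM0)
  -- Optimality is invariant under scaling, so the optimizer can be rescaled to `Q = m`, where `P =
  -- M m^((σ+2)/2) = m`.
  · have ht : 0 ≤ m / quad c ω v := by positivity
    have hQ : quad c ω (Real.sqrt (m / quad c ω v) • v) = m := by
      rw [quad_smul hd, Real.sq_sqrt ht, div_mul_cancel₀ _ hv0.ne']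
    refine ⟨Real.sqrt (m / quad c ω v) • v, hQ, ?_⟩
    rw [nehari_eq, hQ, potential_smul, hv, abs_of_nonneg (Real.sqrt_nonneg _), Real.sqrt_eq_rpow,
      ← Real.rpow_mul ht, show 1 / 2 * (σ + 2) = (σ + 2) / 2 by ring, mul_left_comm,
      ← Real.mul_rpow ht hv0.le, div_mul_cancel₀ _ hv0.ne', hmm, sub_self]
  · intro u hQ hK
    refine hasFDerivAt_action_zero hd hb hσ hσ2 hM (hQ.symm ▸ hm0) hK ?_
    rw [hQ, hmm, ← hQ]
    rw [nehari_eq, sub_eq_zero] at hK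
    exact hK.symm

end INLS

end

theorem proposition1p2 (d : ℕ) (hd : 3 ≤ d) (b σ c ω : ℝ) (hb : 0 < b) (hb2 : b < 2)
    (hσ : 0 < σ) (hσ2 : σ < (4 - 2 * b) / ((d : ℝ) - 2)) (hω : 0 < ω)
    (hc : c ≠ 0) (hcd : c < (((d : ℝ) - 2) / 2) ^ 2) :
    (∀ u : INLS.H1 d,
      HasDerivAt (fun t : ℝ => INLS.action b σ c ω (t • u)) (INLS.nehari b σ c ω u) 1) ∧
    IsGLB (INLS.nehariValues d b σ c ω) (INLS.groundLevel d b σ c ω) ∧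
    (INLS.groundStates d b σ c ω).Nonempty ∧
    INLS.groundStates d b σ c ω =
      {u : INLS.H1 d | INLS.action b σ c ω u = INLS.groundLevel d b σ c ω ∧
        INLS.nehari b σ c ω u = 0} := by
  open INLS in
  obtain ⟨m, hm0, hmin, ⟨w, hwQ, hwK⟩, hcrit⟩ := exists_nehari_level hd hb hσ hσ2 hω hcd
  have hp : 0 < σ + 2 := by linarith
  set θ : ℝ := 1 / 2 - 1 / (σ + 2) with hθ
  have hθ0 : 0 < θ := by
    rw [hθ, sub_pos]
    exact one_div_lt_one_div_of_lt (by norm_num) (by linarith)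
  have hS : ∀ u : H1 d, nehari b σ c ω u = 0 → action b σ c ω u = θ * quad c ω u := by
    intro u hu
    rw [nehari_eq, sub_eq_zero] at hu
    rw [action_eq, ← hu, hθ]
    ring
  have hne : ∀ u : H1 d, quad c ω u = m → u ≠ 0 := by
    rintro u hu rfl
    have : quad c ω (0 : H1 d) = 0 := by simp [quad_eq hd]
    exact hm0.ne' (hu.symm.trans this)
  have hleast : IsLeast (nehariValues d b σ c ω) (θ * m) := by
    refine ⟨⟨w, hne w hwQ, hwK, by rw [hS w hwK, hwQ]⟩, ?_⟩
    rintro _ ⟨u, hu0, hu, rfl⟩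
    rw [hS u hu]
    exact mul_le_mul_of_nonneg_left (hmin u hu0 hu) hθ0.le
  have hlevel : groundLevel d b σ c ω = θ * m := hleast.csInf_eq
  have hset : groundStates d b σ c ω =
      {u : H1 d | action b σ c ω u = groundLevel d b σ c ω ∧ nehari b σ c ω u = 0} := by
    rw [hlevel]
    ext u
    constructor
    · rintro ⟨⟨hu0, hu⟩, hle⟩
      have hK := nehari_eq_zero_of_critical hd hσ hu
      refine ⟨le_antisymm ?_ (hleast.2 ⟨u, hu0, hK, rfl⟩), hK⟩
      -- The Nehari minimizer `w` is itself critical, so it competes with any ground state.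
      have := hle w ⟨hne w hwQ, hcrit w hwQ hwK⟩
      rwa [hS w hwK, hwQ] at this
    · rintro ⟨hu, hK⟩
      have hQ : quad c ω u = m := mul_left_cancel₀ hθ0.ne' ((hS u hK).symm.trans hu)
      refine ⟨⟨hne u hQ, hcrit u hQ hK⟩, fun v hv => ?_⟩
      rw [hu]
      exact hleast.2 ⟨v, hv.1, nehari_eq_zero_of_critical hd hσ hv.2, rfl⟩
  refine ⟨hasDerivAt_action_smul hd hσ, hlevel ▸ hleast.isGLB, ?_, hset⟩
  rw [hset, hlevel]
  exact ⟨w, by rw [hS w hwK, hwQ], hwK⟩
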